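/- Let $0<\gamma<\delta<\tfrac12$, $\theta=\frac{\delta-\gamma}{1-2\gamma}$, and $h(x)=-x\log_2x-(1-x)\log_2(1-x)$. In each use of the $(\gamma,\delta)$-unfair noisy channel Bob receives Alice's bit, flipped with a probability $T\in[\gamma,\delta]$; a malicious party chooses $T$ for each use, and otherwise $T$ is arbitrary in $[\gamma,\delta]$ and unknown. Let $0<\beta<h(\gamma)-h(\theta)$, let $\alpha_1,\alpha_2>0$ with $\alpha_1+\alpha_2<\beta$, and for $n\ge 0$ put $l_1=\lceil n(h(\theta)+\alpha_1)\rceil$, $l_2=\lceil n\alpha_2\rceil$, $k=\lceil n(h(\gamma)-h(\theta)-\beta)\rceil$. A class of functions $\mathcal A\to\mathcal B$ is $t$-universal if for pairwise distinct $x_1,\dots,x_t$ and a uniformly random $g$ in the class, $(g(x_1),\dots,g(x_t))$ is uniform on $\mathcal B^t$. There are, for all $n$, a $4n$-universal class $\mathcal G_1$ of functions $\{0,1\}^n\to\{0,1\}^{l_1}$, a $2$-universal class $\mathcal G_2$ of functions $\{0,1\}^n\to\{0,1\}^{l_2}$ and a $2$-universal class $\mathcal E$ of functions $\{0,1\}^n\to\{0,1\}^{k}$.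 Given such classes and $\nu>0$, consider the following protocol with message space $\mathcal C=\{0,1\}^k$. Commitment to $c\in\mathcal C$: (1) Alice sends a uniformly random $x\in\{0,1\}^n$ over the channel and Bob receives $y$; (2) Bob sends a uniformly random $g_1\in\mathcal G_1$; (3) Alice sends $e_1=g_1(x)$; (4) Bob sends a uniformly random $g_2\in\mathcal G_2$; (5) Alice chooses a uniformly random $\mathsf{Ext}\in\mathcal E$ and sends $d=c\oplus\mathsf{Ext}(x)$, $e_2=g_2(x)$ and $\mathsf{Ext}$. Messages other than $x$ are sent without noise; $M$ denotes all of them. Opening: Alice sends $(x,c)$, and Bob accepts if the Hamming distance of $x$ and $y$ is between $(\gamma-\nu)n$ and $(\delta+\nu)n$, $g_1(x)=e_1$, $g_2(x)=e_2$ and $c=\mathsf{Ext}(x)\oplus d$. Then there is $\nu_0>0$, depending only on $\gamma,\delta,\beta,\alpha_1,\alpha_2$, such that for every $0<\nu<\nu_0$ and all such classes the protocol is secure: there is a negligible function $\epsilon(n)$ such that for all $n$ - (soundness) for honest parties, every $c$ and all crossover probabilities in $[\gamma,\delta]$, Bob accepts with probability at least $1-\epsilon(n)$; - (concealment) for every distribution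 of $C$ and every behavior of a dishonest Bob in the commitment phase, $I(C;\mathrm{View}_B)\le\epsilon(n)$, where $\mathrm{View}_B$ consists of his local randomness, $y$ and $M$; - (binding) for all $\tilde c\ne\bar c$ and every strategy of a dishonest Alice, which chooses the channel input, the crossover probabilities, her messages and two strings $\tilde x,\bar x$, the probability that Bob would accept both $(\tilde x,\tilde c)$ and $(\bar x,\bar c)$ is at most $\epsilon(n)$. Moreover, for all $n\ge1$ the commitment rate $\frac1n\log_2|\mathcal C|$ is at least $h(\gamma)-h(\theta)-\beta$ and less than $h(\gamma)-h(\theta)-\beta+\frac1n$ (so it equals $h(\gamma)-h(\theta)-\beta$ whenever $n(h(\gamma)-h(\theta)-\beta)$ is an integer). -/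

import Mathlib

noncomputable section

namespace UNC

/-! ### Bit strings, entropies, negligible functions -/

/-- Bit strings of length `n`. -/
abbrev Bits (n : ℕ) : Type := Fin n → Bool

/-- Bitwise exclusive or. -/
def bxor {n : ℕ} (a b : Bits n) : Bits n := fun i => Bool.xor (a i) (b i)

/-- Binary entropy in bits, `h x = -x log₂ x - (1 - x) log₂ (1 - x)`. -/
def h (x : ℝ) : ℝ := Real.binEntropy x / Real.log 2

/-- The probability of the event `E` under the distribution `p`. -/
def prob {α : Type} (p : PMF α) (E : Set α) : ℝ := (p.toOuterMeasure E).toReal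

/-- Shannon entropy, in bits, of a random variable with finitely many values. -/
def entropy {α : Type} [Fintype α] (p : PMF α) : ℝ :=
  ∑ a, Real.negMulLog (p a).toReal / Real.log 2

/-- Conditional Shannon entropy `H(A | B) = ∑ b, P(B = b) * H(A | B = b)`, in bits, for a joint
distribution `p` of `(A, B)`. As `0 ≤ H(A | B = b) ≤ log₂ |α|`, the series always converges. -/
def condEntropy {α β : Type} [Fintype α] (p : PMF (α × β)) : ℝ :=
  ∑' b, (p.map Prod.snd b).toReal *
    ∑ a, Real.negMulLog ((p (a, b)).toReal / (p.map Prod.snd b).toReal) / Real.log 2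

/-- Mutual information `I(A ; B) = H(A) - H(A | B)` in bits. -/
def mutualInfo {α β : Type} [Fintype α] (p : PMF (α × β)) : ℝ :=
  entropy (p.map Prod.fst) - condEntropy p

/-- Negligible functions: `n ^ k * ε n → 0` for every `k`. -/
def Negligible (ε : ℕ → ℝ) : Prop :=
  Asymptotics.SuperpolynomialDecay Filter.atTop (fun n : ℕ => (n : ℝ)) ε

/-! ### Hash families -/

/-- A finite nonempty (indexed) class of functions `{0,1}^n → {0,1}^l`; a key is the description
of a function of the class, and drawing a function uniformly means drawing its key uniformly. -/
structure HashFamily (n l : ℕ) where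
  Key : Type
  [fintypeKey : Fintype Key]
  [nonemptyKey : Nonempty Key]
  hash : Key → Bits n → Bits l

attribute [instance] HashFamily.fintypeKey HashFamily.nonemptyKey

/-- The class is `t`-universal: for pairwise distinct `x₁, …, x_t` and a uniformly random function
`g` of the class, `(g x₁, …, g x_t)` is uniform on `({0,1}^l)^t`. -/
def HashFamily.IsUniversal {n l : ℕ} (H : HashFamily n l) (t : ℕ) : Prop :=
  ∀ x : Fin t → Bits n, Function.Injective x →
    (PMF.uniformOfFintype H.Key).map (fun g => fun i => H.hash g (x i)) =
      PMF.uniformOfFintype (Fin t → Bits l)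

/-! ### The unfair noisy channel -/

end UNC

/-- The parameters of a `(γ, δ)`-unfair noisy channel. -/
structure UnfairNoisyChannel where
  γ : ℝ
  δ : ℝ
  γ_pos : 0 < γ
  γ_lt_δ : γ < δ
  δ_lt_half : δ < 1 / 2

namespace UnfairNoisyChannel

open UNC

variable (W : UnfairNoisyChannel)

/-- The crossover probabilities that the channel may have in one use. -/
abbrev Crossover : Type := Set.Icc W.γ W.δ

/-- `θ = (δ - γ) / (1 - 2γ)`. -/
def θ : ℝ := (W.δ - W.γ) / (1 - 2 * W.γ)

/-- One use of the channel with input bit `x` and crossover probability `t`: the law of the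
output bit. -/
def useOnce (t : W.Crossover) (x : Bool) : PMF Bool :=
  PMF.ofFintype (fun y => if y = x then ENNReal.ofReal (1 - t.1) else ENNReal.ofReal t.1) (by
    have h0 : (0 : ℝ) ≤ t.1 := W.γ_pos.le.trans t.2.1
    have h1 : (0 : ℝ) ≤ 1 - t.1 := by linarith [t.2.2, W.δ_lt_half]
    have e : ENNReal.ofReal (1 - t.1) + ENNReal.ofReal t.1 = 1 := by
      rw [← ENNReal.ofReal_add h1 h0]; simp
    cases x <;> simp [e, add_comm _ (ENNReal.ofReal (1 - t.1))])

/-- `n` successive uses of the channel on the input `x`: the law of the output string. The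
crossover probability of each use is determined by `T` from the list of the outputs of the
previous uses. -/
def transmit (T : List Bool → W.Crossover) : (n : ℕ) → Bits n → PMF (Bits n)
  | 0, x => PMF.pure x
  | n + 1, x => do
      let y ← transmit T n (Fin.init x)
      let b ← W.useOnce (T (List.ofFn y)) (x (Fin.last n))
      PMF.pure (Fin.snoc y b)

/-- `n` uses of the channel with crossover probabilities `t 0, …, t (n - 1)` that do not depend
on the outputs. -/
def transmitFixed (t : ℕ → W.Crossover) (n : ℕ) (x : Bits n) : PMF (Bits n) :=
  W.transmit (fun past => t past.length) n x

end UnfairNoisyChannel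

namespace UNC

/-! ### The protocol -/

/-- The parameters of the two-round hash challenge-response commitment protocol with `n` uses of
the channel: the slack `ν` of the distance test, the classes from which the two challenge hash
functions are drawn, and the class from which the extractor is drawn. The message space is
`{0,1}^k`. -/
structure HashProtocol (n l₁ l₂ k : ℕ) where
  ν : ℝ
  G₁ : HashFamily n l₁
  G₂ : HashFamily n l₂
  Ext : HashFamily n k

namespace HashProtocol

variable {n l₁ l₂ k : ℕ} (P : HashProtocol n l₁ l₂ k) (W : UnfairNoisyChannel)

/-- The noiseless conversation of the commitment phase, in the order of the messages: `g₁` (Bob),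
`e₁` (Alice), `g₂` (Bob), and `d`, `e₂`, `ext` (Alice). -/
structure Transcript where
  g₁ : P.G₁.Key
  e₁ : Bits l₁
  g₂ : P.G₂.Key
  d : Bits k
  e₂ : Bits l₂
  ext : P.Ext.Key

/-- Bob's test in the opening phase, for the opened string `x` and value `c`, when Bob received `y`
over the noisy channel and the noiseless conversation was `m`. -/
def Accepts (x y : Bits n) (m : P.Transcript) (c : Bits k) : Prop :=
  W.γ * n - P.ν * n ≤ (hammingDist x y : ℝ) ∧
  (hammingDist x y : ℝ) ≤ W.δ * n + P.ν * n ∧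
  P.G₁.hash m.g₁ x = m.e₁ ∧
  P.G₂.hash m.g₂ x = m.e₂ ∧
  c = bxor (P.Ext.hash m.ext x) m.d

/-- The commitment phase between honest parties on Alice's input `c`, over a channel with
crossover probabilities `t`: the joint law of `(X^n, Y^n, M)`. -/
def honestRun (t : ℕ → W.Crossover) (c : Bits k) : PMF (Bits n × Bits n × P.Transcript) := do
  let x ← PMF.uniformOfFintype (Bits n)
  let y ← W.transmitFixed t n x
  let g₁ ← PMF.uniformOfFintype P.G₁.Key
  let g₂ ← PMF.uniformOfFintype P.G₂.Key
  let ext ← PMF.uniformOfFintype P.Ext.Key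
  PMF.pure (x, y,
    { g₁ := g₁, e₁ := P.G₁.hash g₁ x, g₂ := g₂,
      d := bxor c (P.Ext.hash ext x), e₂ := P.G₂.hash g₂ x, ext := ext })

/-- `ε`-soundness. The honest parties do not control the crossover probabilities, which are
arbitrary in `[γ, δ]`. -/
def Sound (ε : ℝ) : Prop :=
  ∀ (t : ℕ → W.Crossover) (c : Bits k),
    1 - ε ≤ prob (P.honestRun W t c) {s | P.Accepts W s.1 s.2.1 s.2.2 c}

/-- An arbitrary behavior of a dishonest Bob in the commitment phase. He has private coins `R`,
sets the crossover probability of each use of the channel (knowing the previous outputs), and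
chooses both challenges as he likes from all he has seen so far. -/
structure DishonestBob where
  R : Type
  coins : PMF R
  crossover : R → List Bool → W.Crossover
  challenge₁ : R → Bits n → P.G₁.Key
  challenge₂ : R → Bits n → Bits l₁ → P.G₂.Key

/-- The view of a dishonest Bob after the commitment phase: his coins, the string received over the
noisy channel, and the noiseless conversation. -/
abbrev View (B : P.DishonestBob W) : Type := B.R × Bits n × P.Transcript

/-- The commitment phase between honest Alice, whose input has law `pC`, and a dishonest Bob: the
joint law of `(C, View_B)`. -/
def bobRun (B : P.DishonestBob W) (pC : PMF (Bits k)) : PMF (Bits k × P.View W B) := do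
  let c ← pC
  let r ← B.coins
  let x ← PMF.uniformOfFintype (Bits n)
  let y ← W.transmit (B.crossover r) n x
  let ext ← PMF.uniformOfFintype P.Ext.Key
  let g₁ := B.challenge₁ r y
  let e₁ := P.G₁.hash g₁ x
  let g₂ := B.challenge₂ r y e₁
  PMF.pure (c, r, y,
    { g₁ := g₁, e₁ := e₁, g₂ := g₂,
      d := bxor c (P.Ext.hash ext x), e₂ := P.G₂.hash g₂ x, ext := ext })

/-- `ε`-concealment: `I(C ; View_B) ≤ ε`, for every law of `C` and every behavior of Bob. -/
def Concealing (ε : ℝ) : Prop :=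
  ∀ (pC : PMF (Bits k)) (B : P.DishonestBob W), mutualInfo (P.bobRun W B pC) ≤ ε

/-- An arbitrary strategy of a dishonest Alice. She has private coins `R`, chooses the input of the
channel and the crossover probability of each use, her answers to the challenges of Bob, and two
strings to be presented in the opening phase. -/
structure DishonestAlice where
  R : Type
  coins : PMF R
  input : R → Bits n
  crossover : R → ℕ → W.Crossover
  answer₁ : R → P.G₁.Key → Bits l₁
  answer₂ : R → P.G₁.Key → P.G₂.Key → Bits k × Bits l₂ × P.Ext.Key
  openA : R → P.G₁.Key → P.G₂.Key → Bits n
  openB : R → P.G₁.Key → P.G₂.Key → Bits n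

/-- The commitment phase between a dishonest Alice and honest Bob, followed by her choice of two
opening strings: the joint law of the two strings, `Y^n` and `M`. -/
def aliceRun (A : P.DishonestAlice W) :
    PMF ((Bits n × Bits n) × Bits n × P.Transcript) := do
  let r ← A.coins
  let y ← W.transmitFixed (A.crossover r) n (A.input r)
  let g₁ ← PMF.uniformOfFintype P.G₁.Key
  let g₂ ← PMF.uniformOfFintype P.G₂.Key
  let a₂ := A.answer₂ r g₁ g₂
  PMF.pure ((A.openA r g₁ g₂, A.openB r g₁ g₂), y,
    { g₁ := g₁, e₁ := A.answer₁ r g₁, g₂ := g₂, d := a₂.1, e₂ := a₂.2.1, ext := a₂.2.2 })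

/-- `ε`-binding. -/
def Binding (ε : ℝ) : Prop :=
  ∀ cA cB : Bits k, cA ≠ cB → ∀ A : P.DishonestAlice W,
    prob (P.aliceRun W A)
      {s | P.Accepts W s.1.1 s.2.1 s.2.2 cA ∧ P.Accepts W s.1.2 s.2.1 s.2.2 cB} ≤ ε

/-- The commitment rate `log₂ |𝒞| / n`. -/
def rate (_P : HashProtocol n l₁ l₂ k) : ℝ := Real.logb 2 (Fintype.card (Bits k)) / n

end HashProtocol

/-- A family of protocols, indexed by the number `n` of channel uses, is secure if for some
negligible `ε` it is `ε`-sound, `ε`-concealing and `ε`-binding. -/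
def Secure (W : UnfairNoisyChannel) {l₁ l₂ k : ℕ → ℕ}
    (P : ∀ n : ℕ, HashProtocol n (l₁ n) (l₂ n) (k n)) : Prop :=
  ∃ ε : ℕ → ℝ, Negligible ε ∧
    ∀ n, (P n).Sound W (ε n) ∧ (P n).Concealing W (ε n) ∧ (P n).Binding W (ε n)

end UNC

end

noncomputable section

namespace UNC

open Finset

/-! ### Probabilities of events -/

/-! Soundness is a Chernoff bound: for honest parties the distance of `x` and `y` is a sum of
independent indicators with mean between `γ n` and `δ n` (`sound_of_slack`).

Binding (`binding_of_slack`). Fix Alice's coins. She chooses her openings without seeing `y`, so a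
string whose expected distance from `y` is at least `(δ + 2ν) n` passes the distance test with
exponentially small probability. The other strings, called compatible, number at most `2 ^ (n (h(θ)
+ O(ν)))` by an exponential weight (`card_compatible_le`): the crossover most favourable to Alice is
`γ`, and then a string at distance `θ n` from her input has expected distance `(γ + θ (1 - 2γ)) n =
δ n` from `y`. As `g₁` outputs more than `n h(θ)` bits by a linear margin, `4n`-universality leaves
fewer than `4n` compatible strings with a given hash value, except with probability `exp (-Ω(n²))`.
The challenge `g₂`, drawn after `e₁` is fixed, then separates these few strings. One string gives
one value, since `d` and the extractor are common to both openings.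

Concealment (`concealing_of_isUniversal`). Once Bob's coins and `y` are fixed, even adaptively
chosen crossovers are constants, so the posterior law of `x` is a product. Its Rényi entropy of
order `1 + s` is least when every crossover is `γ`, and for small `s` it is close to `n h(γ)`. The
hash values cost at most `l₁ + l₂` bits, and up to rounding `k + l₁ + l₂` stays below `n h(γ)` by `n
(β - α₁ - α₂)`. A leftover hash lemma (`sum_rpow_extract_le`) makes the extracted string nearly
uniform given the rest of the view. Its power-sum form bounds the logarithms in the conditional
entropy directly, so mutual information is controlled without passing through statistical distance
(`mutualInfo_maskLaw_le`). -/

lemma monad_bind_eq_bind {α β : Type} (p : PMF α) (f : α → PMF β) : p >>= f = p.bind f := rfl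

lemma prob_nonneg {α : Type} (p : PMF α) (E : Set α) : 0 ≤ prob p E := ENNReal.toReal_nonneg

lemma toOuterMeasure_le_one {α : Type} (p : PMF α) (E : Set α) : p.toOuterMeasure E ≤ 1 := by
  rw [PMF.toOuterMeasure_apply, ← p.tsum_coe]
  exact ENNReal.tsum_le_tsum fun a => Set.indicator_le_self _ _ a

lemma toOuterMeasure_ne_top {α : Type} (p : PMF α) (E : Set α) : p.toOuterMeasure E ≠ ⊤ :=
  ne_top_of_le_ne_top ENNReal.one_ne_top (toOuterMeasure_le_one p E)

lemma prob_mono {α : Type} (p : PMF α) {E F : Set α} (hEF : E ⊆ F) : prob p E ≤ prob p F :=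
  ENNReal.toReal_mono (toOuterMeasure_ne_top _ _) (MeasureTheory.measure_mono hEF)

lemma prob_union_le {α : Type} (p : PMF α) (E F : Set α) :
    prob p (E ∪ F) ≤ prob p E + prob p F := by
  unfold prob
  rw [← ENNReal.toReal_add (toOuterMeasure_ne_top _ _) (toOuterMeasure_ne_top _ _)]
  exact ENNReal.toReal_mono (ENNReal.add_ne_top.2
    ⟨toOuterMeasure_ne_top _ _, toOuterMeasure_ne_top _ _⟩) (MeasureTheory.measure_union_le _ _)

lemma prob_univ {α : Type} (p : PMF α) : prob p Set.univ = 1 := by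
  unfold prob
  rw [(p.toOuterMeasure_apply_eq_one_iff _).2 (Set.subset_univ _), ENNReal.toReal_one]

lemma one_sub_prob_compl_le {α : Type} (p : PMF α) (E : Set α) : 1 - prob p Eᶜ ≤ prob p E := by
  have h1 := prob_union_le p E Eᶜ
  rw [Set.union_compl_self, prob_univ] at h1
  linarith

lemma prob_map {α β : Type} (p : PMF α) (f : α → β) (E : Set β) :
    prob (p.map f) E = prob p (f ⁻¹' E) := by
  unfold prob
  rw [PMF.toOuterMeasure_map_apply]

lemma prob_pure_le {α : Type} (a : α) {E : Set α} {C : ℝ} (hC : 0 ≤ C) (ha : a ∉ E) :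
    prob (PMF.pure a) E ≤ C := by
  unfold prob
  rw [PMF.toOuterMeasure_pure_apply, if_neg ha]
  simpa using hC

lemma prob_bind_le {α β : Type} (p : PMF α) (f : α → PMF β) (E : Set β) {C : ℝ}
    (hC : ∀ a, prob (f a) E ≤ C) : prob (p.bind f) E ≤ C := by
  -- A PMF has nonempty support, so some value of `a` exists and forces `0 ≤ C`.
  obtain ⟨a₀, -⟩ := p.support_nonempty
  have h0 : 0 ≤ C := (prob_nonneg _ _).trans (hC a₀)
  unfold prob at *
  rw [PMF.toOuterMeasure_bind_apply]
  refine ENNReal.toReal_le_of_le_ofReal h0 ?_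
  calc ∑' a, p a * (f a).toOuterMeasure E ≤ ∑' a, p a * ENNReal.ofReal C :=
        ENNReal.tsum_le_tsum fun a => by
          gcongr
          exact (ENNReal.le_ofReal_iff_toReal_le (toOuterMeasure_ne_top _ _) h0).2 (hC a)
    _ = ENNReal.ofReal C := by rw [ENNReal.tsum_mul_right, p.tsum_coe, one_mul]

lemma prob_biUnion_le {α ι : Type} (p : PMF α) (s : Finset ι) (E : ι → Set α) :
    prob p (⋃ i ∈ s, E i) ≤ ∑ i ∈ s, prob p (E i) := by
  classical
  induction s using Finset.induction_on with
  | empty => simp [prob]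
  | insert a s ha ih =>
    rw [Finset.sum_insert ha, Finset.set_biUnion_insert]
    exact (prob_union_le _ _ _).trans (by gcongr)

lemma prob_eq_sum {α : Type} [Fintype α] (p : PMF α) (E : Set α) :
    prob p E = ∑ a, E.indicator (fun a => (p a).toReal) a := by
  unfold prob
  rw [PMF.toOuterMeasure_apply_fintype, ENNReal.toReal_sum]
  · refine Finset.sum_congr rfl fun a _ => ?_
    by_cases h : a ∈ E <;> simp [h]
  · intro a _
    by_cases h : a ∈ E <;> simp [h, p.apply_ne_top]

lemma sum_toReal_eq_one {α : Type} [Fintype α] (p : PMF α) : ∑ a, (p a).toReal = 1 := by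
  have h1 := prob_eq_sum p Set.univ
  rw [prob_univ] at h1
  simpa using h1.symm

/-- Markov's inequality for a random variable on a finite space. -/
lemma prob_le_sum {α : Type} [Fintype α] (p : PMF α) (E : Set α) (f : α → ℝ)
    (hf : ∀ a, 0 ≤ f a) (hE : ∀ a ∈ E, 1 ≤ f a) : prob p E ≤ ∑ a, (p a).toReal * f a := by
  rw [prob_eq_sum]
  refine Finset.sum_le_sum fun a _ => ?_
  by_cases h : a ∈ E
  · rw [Set.indicator_of_mem h]
    exact le_mul_of_one_le_right ENNReal.toReal_nonneg (hE a h)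
  · rw [Set.indicator_of_notMem h]
    exact mul_nonneg ENNReal.toReal_nonneg (hf a)

lemma uniform_toReal {α : Type} [Fintype α] [Nonempty α] (a : α) :
    (PMF.uniformOfFintype α a).toReal = (Fintype.card α : ℝ)⁻¹ := by
  simp [PMF.uniformOfFintype_apply]

lemma prob_uniform {α : Type} [Fintype α] [Nonempty α] (s : Finset α) :
    prob (PMF.uniformOfFintype α) (s : Set α) = (s.card : ℝ) / Fintype.card α := by
  unfold prob
  rw [PMF.toOuterMeasure_apply_finset]
  simp [PMF.uniformOfFintype_apply, div_eq_mul_inv]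

/-! ### The law of the channel output -/

end UNC

namespace UnfairNoisyChannel

open UNC Finset

variable (W : UnfairNoisyChannel)

lemma useOnce_toReal (t : W.Crossover) (x y : Bool) :
    (W.useOnce t x y).toReal = if y = x then 1 - t.1 else t.1 := by
  have h0 : (0 : ℝ) ≤ t.1 := W.γ_pos.le.trans t.2.1
  have h1 : (0 : ℝ) ≤ 1 - t.1 := by linarith [t.2.2, W.δ_lt_half]
  unfold useOnce
  rw [PMF.ofFintype_apply]
  split_ifs <;> simp [h0, h1]

lemma transmit_succ_apply (T : List Bool → W.Crossover) (n : ℕ) (x y : Bits (n + 1)) :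
    W.transmit T (n + 1) x y = W.transmit T n (Fin.init x) (Fin.init y) *
      W.useOnce (T (List.ofFn (Fin.init y : Bits n))) (x (Fin.last n)) (y (Fin.last n)) := by
  have key : ∀ (z : Bits n) (b : Bool), (y = Fin.snoc z b) ↔ (z = Fin.init y ∧ b = y (Fin.last n)) := by
    intro z b
    constructor
    · rintro rfl
      exact ⟨(Fin.init_snoc (α := fun _ => Bool) _ _).symm, by simp⟩
    · rintro ⟨rfl, rfl⟩
      exact (Fin.snoc_init_self (α := fun _ => Bool) y).symm
  simp only [transmit, monad_bind_eq_bind]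
  rw [PMF.bind_apply, tsum_eq_single (Fin.init y)]
  · rw [PMF.bind_apply, tsum_eq_single (y (Fin.last n))]
    · rw [PMF.pure_apply, if_pos ((key _ _).2 ⟨rfl, rfl⟩), mul_one]
    · intro b hb
      rw [PMF.pure_apply, if_neg (fun h => hb ((key _ _).1 h).2), mul_zero]
  · intro z hz
    rw [PMF.bind_apply]
    simp only [PMF.pure_apply, key, hz, false_and, if_false, mul_zero, tsum_zero]

/-- Given the output of the channel, the crossover probabilities are determined. -/
lemma exists_transmit_eq_prod (T : List Bool → W.Crossover) (n : ℕ) (y : Bits n) :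
    ∃ t : Fin n → W.Crossover, ∀ x : Bits n,
      (W.transmit T n x y).toReal = ∏ i, (W.useOnce (t i) (x i) (y i)).toReal := by
  induction n with
  | zero =>
    refine ⟨Fin.elim0, fun x => ?_⟩
    simp [transmit, PMF.pure_apply, Subsingleton.elim y x]
  | succ n ih =>
    obtain ⟨t, ht⟩ := ih (Fin.init y)
    refine ⟨Fin.snoc (α := fun _ => W.Crossover) t (T (List.ofFn (Fin.init y : Bits n))), fun x => ?_⟩
    rw [transmit_succ_apply, ENNReal.toReal_mul, ht, Fin.prod_univ_castSucc]
    simp [Fin.init]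

lemma transmitFixed_eq_prod (t : ℕ → W.Crossover) (n : ℕ) (x y : Bits n) :
    (W.transmitFixed t n x y).toReal = ∏ i : Fin n, (W.useOnce (t i) (x i) (y i)).toReal := by
  unfold transmitFixed
  induction n with
  | zero => simp [transmit, PMF.pure_apply, Subsingleton.elim y x]
  | succ n ih =>
    rw [transmit_succ_apply, ENNReal.toReal_mul, ih, Fin.prod_univ_castSucc]
    simp [Fin.init]

end UnfairNoisyChannel

namespace UNC

open Finset

/-! ### Deviations of the Hamming distance -/

lemma sum_prod_bits {n : ℕ} (f : Fin n → Bool → ℝ) :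
    ∑ y : Bits n, ∏ i, f i (y i) = ∏ i, (f i true + f i false) := by
  classical
  have h1 := Finset.prod_univ_sum (fun _ : Fin n => (Finset.univ : Finset Bool)) f
  rw [Fintype.piFinset_univ] at h1
  rw [← h1]
  simp

lemma hammingDist_eq_sum {n : ℕ} (x y : Bits n) :
    (hammingDist x y : ℝ) = ∑ i, if x i ≠ y i then (1 : ℝ) else 0 := by
  simp only [hammingDist, Finset.sum_boole]

/-- Combine `exp l ≤ 1 + l + l ^ 2`, valid for `|l| ≤ 1`, with `1 + u ≤ exp u`. -/
lemma exp_mgf_le {p l : ℝ} (hp0 : 0 ≤ p) (hp1 : p ≤ 1) (hl : |l| ≤ 1) :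
    (1 - p) + p * Real.exp l ≤ Real.exp (l * p + l ^ 2) := by
  have h1 := (abs_le.1 (Real.abs_exp_sub_one_sub_id_le hl)).2
  have h2 := Real.add_one_le_exp (l * p + l ^ 2)
  nlinarith [sq_nonneg l, mul_le_mul_of_nonneg_left h1 hp0, mul_le_mul_of_nonneg_right hp1 (sq_nonneg l)]

/-- Chernoff's bound for the Hamming distance of `x` from a random string whose bits are
independent and differ from those of `x` with probabilities `p i`. -/
lemma prob_hammingDist_le {n : ℕ} (q : PMF (Bits n)) (w : Fin n → Bool → ℝ)
    (hw0 : ∀ i b, 0 ≤ w i b) (hw1 : ∀ i, w i true + w i false = 1)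
    (hq : ∀ y, (q y).toReal = ∏ i, w i (y i)) (x : Bits n) {l : ℝ} (hl : |l| ≤ 1) (a : ℝ) :
    prob q {y | l * ∑ i, w i (!x i) + a ≤ l * (hammingDist x y : ℝ)} ≤
      Real.exp (n * l ^ 2 - a) := by
  set m := ∑ i, w i (!x i) with hm
  refine (prob_le_sum q _ (fun y => Real.exp (l * (hammingDist x y : ℝ) - (l * m + a)))
    (fun y => (Real.exp_pos _).le) (fun y hy => ?_)).trans ?_
  · rw [Real.one_le_exp_iff]
    have : l * m + a ≤ l * (hammingDist x y : ℝ) := hy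
    linarith
  · have e1 : ∀ y : Bits n, (q y).toReal * Real.exp (l * (hammingDist x y : ℝ) - (l * m + a)) =
        Real.exp (-(l * m + a)) *
          ∏ i, (w i (y i) * Real.exp (l * if x i ≠ y i then (1 : ℝ) else 0)) := by
      intro y
      rw [hq, Finset.prod_mul_distrib, ← Real.exp_sum, ← Finset.mul_sum, ← hammingDist_eq_sum,
        sub_eq_add_neg, Real.exp_add]
      ring
    simp only [e1]
    rw [← Finset.mul_sum,
      sum_prod_bits (fun i b => w i b * Real.exp (l * if x i ≠ b then (1 : ℝ) else 0))]
    have e2 : ∀ i, w i true * Real.exp (l * if x i ≠ true then (1 : ℝ) else 0) +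
        w i false * Real.exp (l * if x i ≠ false then (1 : ℝ) else 0) ≤
        Real.exp (l * w i (!x i) + l ^ 2) := by
      intro i
      have h1 := hw1 i
      refine le_trans (le_of_eq ?_) (exp_mgf_le (hw0 i (!x i))
        (by cases x i <;> simp <;> linarith [hw0 i true, hw0 i false]) hl)
      cases x i <;> simp <;> linarith
    calc Real.exp (-(l * m + a)) * _ ≤
        Real.exp (-(l * m + a)) * ∏ i : Fin n, Real.exp (l * w i (!x i) + l ^ 2) := by
          gcongr with i
          · exact fun i _ => add_nonneg (mul_nonneg (hw0 _ _) (Real.exp_pos _).le)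
              (mul_nonneg (hw0 _ _) (Real.exp_pos _).le)
          · exact e2 i
      _ = Real.exp (n * l ^ 2 - a) := by
          rw [← Real.exp_sum, ← Real.exp_add, Finset.sum_add_distrib, ← Finset.mul_sum, ← hm]
          congr 1
          simp
          ring

lemma prob_hammingDist_lower {n : ℕ} (q : PMF (Bits n)) (w : Fin n → Bool → ℝ)
    (hw0 : ∀ i b, 0 ≤ w i b) (hw1 : ∀ i, w i true + w i false = 1)
    (hq : ∀ y, (q y).toReal = ∏ i, w i (y i)) (x : Bits n) {ν : ℝ} (hν0 : 0 < ν) (hν1 : ν ≤ 1) :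
    prob q {y | (hammingDist x y : ℝ) ≤ ∑ i, w i (!x i) - ν * n} ≤
      Real.exp (-(ν ^ 2 / 4) * n) := by
  -- The choice `|l| = ν / 2` minimises `n * l ^ 2 - |l| * ν * n`; the minimum is the exponent `-(ν
  -- ^ 2 / 4) * n`.
  have hl : |-(ν / 2)| ≤ 1 := by rw [abs_neg, abs_of_pos (by positivity)]; linarith
  refine le_trans (prob_mono _ fun y hy => ?_)
    ((prob_hammingDist_le q w hw0 hw1 hq x hl (ν / 2 * (ν * n))).trans (le_of_eq ?_))
  · have hy' : (hammingDist x y : ℝ) ≤ ∑ i, w i (!x i) - ν * n := hy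
    have := mul_le_mul_of_nonneg_left hy' (by positivity : 0 ≤ ν / 2)
    rw [Set.mem_ofPred_eq]
    linarith
  · congr 1
    ring

lemma prob_hammingDist_upper {n : ℕ} (q : PMF (Bits n)) (w : Fin n → Bool → ℝ)
    (hw0 : ∀ i b, 0 ≤ w i b) (hw1 : ∀ i, w i true + w i false = 1)
    (hq : ∀ y, (q y).toReal = ∏ i, w i (y i)) (x : Bits n) {ν : ℝ} (hν0 : 0 < ν) (hν1 : ν ≤ 1) :
    prob q {y | ∑ i, w i (!x i) + ν * n ≤ (hammingDist x y : ℝ)} ≤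
      Real.exp (-(ν ^ 2 / 4) * n) := by
  have hl : |ν / 2| ≤ 1 := by rw [abs_of_pos (by positivity)]; linarith
  refine le_trans (prob_mono _ fun y hy => ?_)
    ((prob_hammingDist_le q w hw0 hw1 hq x hl (ν / 2 * (ν * n))).trans (le_of_eq ?_))
  · have hy' : ∑ i, w i (!x i) + ν * n ≤ (hammingDist x y : ℝ) := hy
    have := mul_le_mul_of_nonneg_left hy' (by positivity : 0 ≤ ν / 2)
    rw [Set.mem_ofPred_eq]
    linarith
  · congr 1
    ring

end UNC

namespace UNC

open Finset

/-- Split off the bad event `A` for the first draw, where the second probability is bounded by `1`.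
This is how each exceptional event of the protocol is charged. -/
lemma prob_bind_le_add {α β : Type} (p : PMF α) (f : α → PMF β) (A : Set α) (E : Set β) {C : ℝ}
    (hC0 : 0 ≤ C) (hC : ∀ a ∉ A, prob (f a) E ≤ C) : prob (p.bind f) E ≤ prob p A + C := by
  unfold prob at *
  refine ENNReal.toReal_le_of_le_ofReal (add_nonneg ENNReal.toReal_nonneg hC0) ?_
  rw [ENNReal.ofReal_add ENNReal.toReal_nonneg hC0,
    ENNReal.ofReal_toReal (toOuterMeasure_ne_top _ _), PMF.toOuterMeasure_bind_apply,
    PMF.toOuterMeasure_apply]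
  calc ∑' a, p a * (f a).toOuterMeasure E
      ≤ ∑' a, (A.indicator p a + p a * ENNReal.ofReal C) := by
        refine ENNReal.tsum_le_tsum fun a => ?_
        by_cases ha : a ∈ A
        · rw [Set.indicator_of_mem ha]
          exact le_add_right (mul_le_of_le_one_right' (toOuterMeasure_le_one _ _))
        · rw [Set.indicator_of_notMem ha, zero_add]
          gcongr
          exact (ENNReal.le_ofReal_iff_toReal_le (toOuterMeasure_ne_top _ _) hC0).2 (hC a ha)
    _ = _ := by rw [ENNReal.tsum_add, ENNReal.tsum_mul_right, p.tsum_coe, one_mul]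

/-! ### Soundness -/

lemma useOnce_toReal_nonneg (W : UnfairNoisyChannel) (t : W.Crossover) (x y : Bool) :
    0 ≤ (W.useOnce t x y).toReal := ENNReal.toReal_nonneg

lemma useOnce_toReal_add (W : UnfairNoisyChannel) (t : W.Crossover) (x : Bool) :
    (W.useOnce t x true).toReal + (W.useOnce t x false).toReal = 1 := by
  simp only [UnfairNoisyChannel.useOnce_toReal]
  cases x <;> simp

namespace HashProtocol

variable {n l₁ l₂ k : ℕ} (P : HashProtocol n l₁ l₂ k) (W : UnfairNoisyChannel)

lemma bxor_bxor_cancel_left {m : ℕ} (a b : Bits m) : bxor a (bxor a b) = b := by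
  funext i
  simp [bxor]

lemma bxor_comm {m : ℕ} (a b : Bits m) : bxor a b = bxor b a := by
  funext i
  simp [bxor, Bool.xor_comm]

lemma sound_of_slack (hν0 : 0 < P.ν) (hν1 : P.ν ≤ 1) :
    P.Sound W (2 * Real.exp (-(P.ν ^ 2 / 4) * n)) := by
  intro t c
  refine le_trans ?_ (one_sub_prob_compl_le _ _)
  gcongr
  unfold honestRun
  simp only [monad_bind_eq_bind]
  refine prob_bind_le _ _ _ fun x => ?_
  set w : Fin n → Bool → ℝ := fun i b => (W.useOnce (t i) (x i) b).toReal with hw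
  have hq := W.transmitFixed_eq_prod t n x
  have hw0 : ∀ i b, 0 ≤ w i b := fun i b => useOnce_toReal_nonneg _ _ _ _
  have hw1 : ∀ i, w i true + w i false = 1 := fun i => useOnce_toReal_add _ _ _
  have h1 := prob_hammingDist_lower _ w hw0 hw1 hq x hν0 hν1
  have h2 := prob_hammingDist_upper _ w hw0 hw1 hq x hν0 hν1
  have hm : ∀ i, w i (!x i) = (t i).1 := by
    intro i
    simp only [hw, UnfairNoisyChannel.useOnce_toReal]
    cases x i <;> simp
  have hm1 : W.γ * n ≤ ∑ i, w i (!x i) := by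
    calc W.γ * n = ∑ _i : Fin n, W.γ := by simp [mul_comm]
      _ ≤ _ := Finset.sum_le_sum fun i _ => by rw [hm]; exact (t i).2.1
  have hm2 : ∑ i, w i (!x i) ≤ W.δ * n := by
    calc _ ≤ ∑ _i : Fin n, W.δ := Finset.sum_le_sum fun i _ => by rw [hm]; exact (t i).2.2
      _ = W.δ * n := by simp [mul_comm]
  refine (prob_bind_le_add _ _ ({y | (hammingDist x y : ℝ) ≤ ∑ i, w i (!x i) - P.ν * n} ∪
    {y | ∑ i, w i (!x i) + P.ν * n ≤ (hammingDist x y : ℝ)}) _ le_rfl ?_).trans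
    (b := _) ?_
  · intro y hy
    rw [Set.mem_union, not_or, Set.mem_ofPred_eq, Set.mem_ofPred_eq, not_le, not_le] at hy
    refine prob_bind_le _ _ _ fun g₁ => prob_bind_le _ _ _ fun g₂ => prob_bind_le _ _ _ fun e => ?_
    refine prob_pure_le _ le_rfl ?_
    rw [Set.notMem_compl_iff]
    refine ⟨by simp only; linarith [hy.1], by simp only; linarith [hy.2], rfl, rfl, ?_⟩
    simp only
    rw [bxor_comm c, bxor_bxor_cancel_left]
  · rw [add_zero]
    refine (prob_union_le _ _ _).trans ?_
    linarith

end HashProtocol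

/-! ### Collisions of universal hash functions -/

lemma card_bits (l : ℕ) : Fintype.card (Bits l) = 2 ^ l := by simp

/-- At most `2 ^ l` of the `(2 ^ l) ^ t` equally likely value tuples are constant. -/
lemma HashFamily.IsUniversal.prob_const_le {n l t : ℕ} {H : HashFamily n l} (hH : H.IsUniversal t)
    (x : Fin t → Bits n) (hx : Function.Injective x) :
    prob (PMF.uniformOfFintype H.Key) {g | ∃ v, ∀ i, H.hash g (x i) = v} ≤
      2 ^ l / (2 ^ l) ^ t := by
  classical
  have h1 : {g | ∃ v, ∀ i, H.hash g (x i) = v} = (fun g => fun i => H.hash g (x i)) ⁻¹'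
      ((Finset.univ.image fun v : Bits l => fun _ : Fin t => v : Finset (Fin t → Bits l)) : Set _) := by
    ext g
    simp only [Set.mem_ofPred_eq, Set.mem_preimage, Finset.mem_coe, Finset.mem_image,
      Finset.mem_univ, true_and, funext_iff, eq_comm]
  rw [h1, ← prob_map, hH x hx, prob_uniform]
  have h2 : (Fintype.card (Fin t → Bits l) : ℝ) = (2 ^ l) ^ t := by
    simp
  rw [h2]
  gcongr
  have h3 := Finset.card_image_le (s := (Finset.univ : Finset (Bits l)))
    (f := fun v : Bits l => fun _ : Fin t => v)
  rw [Finset.card_univ, card_bits] at h3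
  exact_mod_cast h3

lemma HashFamily.IsUniversal.prob_collision_le {n l : ℕ} {H : HashFamily n l}
    (hH : H.IsUniversal 2) {x x' : Bits n} (hx : x ≠ x') :
    prob (PMF.uniformOfFintype H.Key) {g | H.hash g x = H.hash g x'} ≤ (2 ^ l)⁻¹ := by
  have h1 := hH.prob_const_le ![x, x'] (by
    intro i j hij
    fin_cases i <;> fin_cases j <;> simp_all)
  refine (prob_mono _ ?_).trans (h1.trans (le_of_eq ?_))
  · intro g hg
    exact ⟨H.hash g x', fun i => by fin_cases i <;> simp_all⟩
  · field_simp

/-- Hashing with a `t`-universal class rarely sends `t` strings of a small set to one value. -/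
lemma HashFamily.IsUniversal.prob_large_fibre_le {n l t : ℕ} {H : HashFamily n l}
    (hH : H.IsUniversal t) (S : Finset (Bits n)) :
    prob (PMF.uniformOfFintype H.Key) {g | ∃ e, t ≤ #{x ∈ S | H.hash g x = e}} ≤
      (#S : ℝ) ^ t * (2 ^ l / (2 ^ l) ^ t) := by
  classical
  set I : Finset (Fin t → Bits n) :=
    (Fintype.piFinset fun _ : Fin t => S).filter Function.Injective with hI
  refine (prob_mono _ (F := ⋃ x ∈ I, {g | ∃ v, ∀ i, H.hash g (x i) = v}) ?_).trans
    ((prob_biUnion_le _ _ _).trans ?_)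
  · rintro g ⟨e, he⟩
    -- The first `t` members of the fibre, in some enumeration, form an injective tuple on which the
    -- hash is constant; the union bound runs over such tuples.
    set F := {x ∈ S | H.hash g x = e} with hF
    have hmem : ∀ i : Fin t, (F.equivFin.symm (Fin.castLE he i)).1 ∈ F := fun i => Subtype.property _
    simp only [Set.mem_iUnion]
    refine ⟨fun i => (F.equivFin.symm (Fin.castLE he i)).1, ?_, e, fun i => ?_⟩
    · rw [hI, Finset.mem_filter, Fintype.mem_piFinset]
      refine ⟨fun i => (Finset.mem_filter.1 (hmem i)).1, fun i j hij => ?_⟩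
      have := F.equivFin.symm.injective (Subtype.ext hij)
      exact Fin.castLE_injective he this
    · exact (Finset.mem_filter.1 (hmem i)).2
  · calc _ ≤ ∑ _x ∈ I, (2 : ℝ) ^ l / (2 ^ l) ^ t := Finset.sum_le_sum fun x hx =>
          hH.prob_const_le x (Finset.mem_filter.1 hx).2
      _ = #I * ((2 : ℝ) ^ l / (2 ^ l) ^ t) := by rw [Finset.sum_const, nsmul_eq_mul]
      _ ≤ _ := by
        gcongr
        have h1 : #I ≤ #S ^ t := by
          refine (Finset.card_filter_le _ _).trans ?_
          rw [Fintype.card_piFinset]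
          simp
        exact_mod_cast h1

lemma HashFamily.IsUniversal.prob_exists_collision_le {n l : ℕ} {H : HashFamily n l}
    (hH : H.IsUniversal 2) (F : Finset (Bits n)) :
    prob (PMF.uniformOfFintype H.Key)
      {g | ∃ x ∈ F, ∃ x' ∈ F, x ≠ x' ∧ H.hash g x = H.hash g x'} ≤ (#F : ℝ) ^ 2 * (2 ^ l)⁻¹ := by
  classical
  refine (prob_mono _ (F := ⋃ x ∈ F.offDiag, {g | H.hash g x.1 = H.hash g x.2}) ?_).trans
    ((prob_biUnion_le _ _ _).trans ?_)
  · rintro g ⟨x, hx, x', hx', hne, h⟩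
    simp only [Set.mem_iUnion]
    exact ⟨(x, x'), Finset.mem_offDiag.2 ⟨hx, hx', hne⟩, h⟩
  · calc _ ≤ ∑ _x ∈ F.offDiag, ((2 : ℝ) ^ l)⁻¹ := Finset.sum_le_sum fun x hx =>
          hH.prob_collision_le (Finset.mem_offDiag.1 hx).2.2
      _ = #F.offDiag * ((2 : ℝ) ^ l)⁻¹ := by rw [Finset.sum_const, nsmul_eq_mul]
      _ ≤ _ := by
        gcongr
        have h1 : #F.offDiag ≤ #F ^ 2 := by
          rw [Finset.offDiag_card, sq]
          exact Nat.sub_le _ _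
        exact_mod_cast h1

/-! ### The strings compatible with the channel -/

/-- The point `t` lies between `a` and `1 - a`, where `f` takes the same value, and a convex
function on an interval is largest at an endpoint. Both uses of this lemma show that `γ` is the
extremal crossover probability. -/
lemma ConvexOn.le_of_symm {f : ℝ → ℝ} (hf : ConvexOn ℝ (Set.Icc 0 1) f)
    (hsymm : ∀ t, f (1 - t) = f t) {a t : ℝ} (ha : 0 ≤ a) (hat : a ≤ t) (ht : t ≤ 1 / 2) :
    f t ≤ f a := by
  have h1 := hf.le_max_of_mem_Icc (x := a) (y := 1 - a) (z := t)
    ⟨ha, by linarith⟩ ⟨by linarith, by linarith⟩ ⟨hat, by linarith⟩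
  rwa [hsymm, max_self] at h1

end UNC

namespace UnfairNoisyChannel

open UNC Finset

variable (W : UnfairNoisyChannel)

lemma θ_pos : 0 < W.θ :=
  div_pos (by linarith [W.γ_lt_δ]) (by linarith [W.γ_lt_δ, W.δ_lt_half])

lemma θ_lt_half : W.θ < 1 / 2 := by
  have h1 : 0 < 1 - 2 * W.γ := by linarith [W.γ_lt_δ, W.δ_lt_half]
  unfold θ
  rw [div_lt_iff₀ h1]
  linarith [W.δ_lt_half]

lemma θ_mul : W.θ * (1 - 2 * W.γ) = W.δ - W.γ := by
  have h1 : 0 < 1 - 2 * W.γ := by linarith [W.γ_lt_δ, W.δ_lt_half]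
  exact div_mul_cancel₀ _ h1.ne'

/-- The exponent of the optimal Chernoff bound for the number of strings compatible with the
channel. -/
def slope : ℝ := (Real.log (1 - W.θ) - Real.log W.θ) / (1 - 2 * W.γ)

lemma slope_pos : 0 < W.slope := by
  have h1 : 0 < 1 - 2 * W.γ := by linarith [W.γ_lt_δ, W.δ_lt_half]
  refine div_pos (sub_pos.2 (Real.log_lt_log W.θ_pos ?_)) h1
  linarith [W.θ_lt_half]

lemma slope_mul : W.slope * (1 - 2 * W.γ) = Real.log (1 - W.θ) - Real.log W.θ := by
  have h1 : 0 < 1 - 2 * W.γ := by linarith [W.γ_lt_δ, W.δ_lt_half]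
  unfold slope
  field_simp

/-- The left side is convex and symmetric under `t ↦ 1 - t`, so it is largest at `t = γ`. There
equality holds: the slope makes the ratio of the two exponentials `θ / (1 - θ)`. -/
lemma exp_slope_add (t : W.Crossover) :
    Real.exp (-W.slope * t.1) + Real.exp (-W.slope * (1 - t.1)) ≤
      Real.exp (Real.binEntropy W.θ - W.slope * W.δ) := by
  have hθ := W.θ_pos
  have hθ' : 0 < 1 - W.θ := by linarith [W.θ_lt_half]
  have hconv : ConvexOn ℝ (Set.Icc (0 : ℝ) 1)
      (fun t => Real.exp (-W.slope * t) + Real.exp (-W.slope * (1 - t))) := by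
    have h1 : ConvexOn ℝ Set.univ (fun t : ℝ => Real.exp (-W.slope * t)) :=
      convexOn_exp.comp_linearMap (LinearMap.mul ℝ ℝ (-W.slope))
    have h2 : ConvexOn ℝ Set.univ (fun t : ℝ => Real.exp (-W.slope * (1 - t))) := by
      have h3 : ConvexOn ℝ Set.univ (fun t : ℝ => Real.exp (W.slope * t)) :=
        convexOn_exp.comp_linearMap (LinearMap.mul ℝ ℝ W.slope)
      have h4 := h3.smul (Real.exp_pos (-W.slope)).le
      refine h4.congr fun t _ => ?_
      simp only [smul_eq_mul]
      rw [← Real.exp_add]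
      congr 1
      ring
    exact (h1.add h2).subset (Set.subset_univ _) (convex_Icc _ _)
  have h1 := ConvexOn.le_of_symm hconv (fun t => by ring_nf) W.γ_pos.le t.2.1
    (by linarith [t.2.2, W.δ_lt_half])
  refine h1.trans (le_of_eq ?_)
  have e1 : -W.slope * (1 - W.γ) = -W.slope * W.γ + (Real.log W.θ - Real.log (1 - W.θ)) := by
    linear_combination -W.slope_mul
  have e2 : Real.binEntropy W.θ - W.slope * W.δ = -W.slope * W.γ - Real.log (1 - W.θ) := by
    rw [Real.binEntropy_eq_negMulLog_add_negMulLog_one_sub]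
    unfold Real.negMulLog
    linear_combination W.slope * W.θ_mul - W.θ * W.slope_mul
  rw [e1, e2, Real.exp_add, Real.exp_sub, Real.exp_sub, Real.exp_log hθ, Real.exp_log hθ']
  field_simp
  ring

/-- The strings whose expected distance from the output of the channel on input `x₀` is less than
`(δ + 2ν) n`. -/
def compatible {n : ℕ} (t : ℕ → W.Crossover) (x₀ : Bits n) (ν : ℝ) : Finset (Bits n) :=
  {x | ∑ i : Fin n, (W.useOnce (t i) (x₀ i) (!x i)).toReal < (W.δ + 2 * ν) * n}

/-- Each compatible string has exponential weight at least `1`. The sum of the weights over all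
strings factorises over the coordinates, and `exp_slope_add` bounds each factor. -/
lemma card_compatible_le {n : ℕ} (t : ℕ → W.Crossover) (x₀ : Bits n) (ν : ℝ) :
    (#(W.compatible t x₀ ν) : ℝ) ≤
      Real.exp (n * (Real.binEntropy W.θ + 2 * ν * W.slope)) := by
  set m : Bits n → ℝ := fun x => ∑ i : Fin n, (W.useOnce (t i) (x₀ i) (!x i)).toReal with hm
  calc (#(W.compatible t x₀ ν) : ℝ) = ∑ _x ∈ W.compatible t x₀ ν, (1 : ℝ) := by simp
    _ ≤ ∑ x ∈ W.compatible t x₀ ν, Real.exp (W.slope * ((W.δ + 2 * ν) * n - m x)) := by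
        refine Finset.sum_le_sum fun x hx => ?_
        rw [Real.one_le_exp_iff]
        have h1 : m x < (W.δ + 2 * ν) * n := (Finset.mem_filter.1 hx).2
        exact mul_nonneg W.slope_pos.le (by linarith)
    _ ≤ ∑ x, Real.exp (W.slope * ((W.δ + 2 * ν) * n - m x)) :=
        Finset.sum_le_sum_of_subset_of_nonneg (Finset.subset_univ _)
          fun _ _ _ => (Real.exp_pos _).le
    _ = Real.exp (W.slope * ((W.δ + 2 * ν) * n)) *
        ∑ x : Bits n, ∏ i : Fin n,
          Real.exp (-W.slope * (W.useOnce (t i) (x₀ i) (!x i)).toReal) := by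
        rw [Finset.mul_sum]
        refine Finset.sum_congr rfl fun x _ => ?_
        rw [← Real.exp_sum, ← Real.exp_add, ← Finset.mul_sum]
        congr 1
        simp only [hm]
        ring
    _ = Real.exp (W.slope * ((W.δ + 2 * ν) * n)) * ∏ i : Fin n,
          (Real.exp (-W.slope * (t i).1) + Real.exp (-W.slope * (1 - (t i).1))) := by
        rw [sum_prod_bits
          (fun i b => Real.exp (-W.slope * (W.useOnce (t i) (x₀ i) (!b)).toReal))]
        congr 1
        refine Finset.prod_congr rfl fun i _ => ?_
        simp only [useOnce_toReal]
        cases x₀ i <;> simp [add_comm]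
    _ ≤ Real.exp (W.slope * ((W.δ + 2 * ν) * n)) * ∏ _i : Fin n,
          Real.exp (Real.binEntropy W.θ - W.slope * W.δ) := by
        gcongr with i
        exact W.exp_slope_add _
    _ = _ := by
        rw [← Real.exp_sum, ← Real.exp_add]
        congr 1
        simp
        ring

end UnfairNoisyChannel

namespace UNC

open Finset

/-! ### Binding -/

namespace HashProtocol

variable {n l₁ l₂ k : ℕ} (P : HashProtocol n l₁ l₂ k) (W : UnfairNoisyChannel)

lemma binding_of_slack (hν0 : 0 < P.ν) (hν1 : P.ν ≤ 1) (hG₁ : P.G₁.IsUniversal (4 * n))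
    (hG₂ : P.G₂.IsUniversal 2) :
    P.Binding W (2 * Real.exp (-(P.ν ^ 2 / 4) * n) +
      (Real.exp (n * (Real.binEntropy W.θ + 2 * P.ν * W.slope)) ^ (4 * n) *
        (2 ^ l₁ / (2 ^ l₁) ^ (4 * n)) + (4 * n) ^ 2 * (2 ^ l₂)⁻¹)) := by
  intro cA cB hc A
  unfold aliceRun
  simp only [monad_bind_eq_bind]
  refine prob_bind_le _ _ _ fun r => ?_
  set S := W.compatible (A.crossover r) (A.input r) P.ν with hS
  set q := W.transmitFixed (A.crossover r) n (A.input r) with hq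
  set run := q.bind fun y => (PMF.uniformOfFintype P.G₁.Key).bind fun g₁ =>
    (PMF.uniformOfFintype P.G₂.Key).bind fun g₂ =>
      PMF.pure (((A.openA r g₁ g₂, A.openB r g₁ g₂), y,
        { g₁ := g₁, e₁ := A.answer₁ r g₁, g₂ := g₂, d := (A.answer₂ r g₁ g₂).1,
          e₂ := (A.answer₂ r g₁ g₂).2.1, ext := (A.answer₂ r g₁ g₂).2.2 }) :
        (Bits n × Bits n) × Bits n × P.Transcript) with hrun
  have hfar : ∀ x ∉ S, prob q {y | (hammingDist x y : ℝ) ≤ W.δ * n + P.ν * n} ≤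
      Real.exp (-(P.ν ^ 2 / 4) * n) := by
    intro x hx
    refine (prob_mono _ fun y hy => ?_).trans (prob_hammingDist_lower q
      (fun i b => (W.useOnce (A.crossover r i) (A.input r i) b).toReal)
      (fun i b => useOnce_toReal_nonneg _ _ _ _) (fun i => useOnce_toReal_add _ _ _)
      (W.transmitFixed_eq_prod _ n _) x hν0 hν1)
    have h1 : (hammingDist x y : ℝ) ≤ W.δ * n + P.ν * n := hy
    have h2 : ¬ (∑ i : Fin n, (W.useOnce (A.crossover r i) (A.input r i) (!x i)).toReal <
        (W.δ + 2 * P.ν) * n) := fun h => hx (Finset.mem_filter.2 ⟨Finset.mem_univ _, h⟩)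
    rw [Set.mem_ofPred_eq]
    linarith [not_lt.1 h2]
  have hfar_run : ∀ o : P.G₁.Key → P.G₂.Key → Bits n, ∀ E : Set _,
      (∀ s ∈ E, o s.2.2.g₁ s.2.2.g₂ ∉ S ∧
        (hammingDist (o s.2.2.g₁ s.2.2.g₂) s.2.1 : ℝ) ≤ W.δ * n + P.ν * n) →
      prob run E ≤ Real.exp (-(P.ν ^ 2 / 4) * n) := by
    intro o E hE
    -- Draw `y` last: the challenges are independent of it and the openings depend only on coins and
    -- challenges, so the opened string is fixed before `y` is drawn.
    rw [hrun, PMF.bind_comm]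
    refine prob_bind_le _ _ _ fun g₁ => ?_
    rw [PMF.bind_comm]
    refine prob_bind_le _ _ _ fun g₂ => ?_
    by_cases hx : o g₁ g₂ ∈ S
    · refine prob_bind_le _ _ _ fun y => prob_pure_le _ (Real.exp_pos _).le fun h => ?_
      exact (hE _ h).1 hx
    · refine (prob_bind_le_add _ _ _ _ le_rfl fun y hy => prob_pure_le _ le_rfl fun h => ?_).trans
        ((add_zero _).trans_le (hfar _ hx))
      exact hy (hE _ h).2
  -- Besides acceptance, `acc` records the identities that tie an outcome to Alice's strategy. They
  -- hold on the support of `run`, so accepting outcomes outside `acc` have probability `0`.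
  set acc : Set ((Bits n × Bits n) × Bits n × P.Transcript) :=
    {s | P.Accepts W s.1.1 s.2.1 s.2.2 cA ∧ P.Accepts W s.1.2 s.2.1 s.2.2 cB ∧
      A.openA r s.2.2.g₁ s.2.2.g₂ = s.1.1 ∧ A.openB r s.2.2.g₁ s.2.2.g₂ = s.1.2 ∧
      s.2.2.e₁ = A.answer₁ r s.2.2.g₁} with hacc
  have hsub : {s | P.Accepts W s.1.1 s.2.1 s.2.2 cA ∧ P.Accepts W s.1.2 s.2.1 s.2.2 cB} ⊆
      accᶜ ∩ {s | P.Accepts W s.1.1 s.2.1 s.2.2 cA ∧ P.Accepts W s.1.2 s.2.1 s.2.2 cB} ∪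
      ((acc ∩ {s | A.openA r s.2.2.g₁ s.2.2.g₂ ∉ S}) ∪
        ((acc ∩ {s | A.openB r s.2.2.g₁ s.2.2.g₂ ∉ S}) ∪
        (acc ∩ {s | s.1.1 ∈ S ∧ s.1.2 ∈ S}))) := by
    intro s hs
    by_cases h1 : s ∈ acc
    · right
      by_cases h2 : A.openA r s.2.2.g₁ s.2.2.g₂ ∈ S
      · right
        by_cases h3 : A.openB r s.2.2.g₁ s.2.2.g₂ ∈ S
        · right
          exact ⟨h1, by rw [← h1.2.2.1]; exact h2, by rw [← h1.2.2.2.1]; exact h3⟩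
        · exact Or.inl ⟨h1, h3⟩
      · exact Or.inl ⟨h1, h2⟩
    · exact Or.inl ⟨h1, hs⟩
  have h0 : prob run (accᶜ ∩ {s | P.Accepts W s.1.1 s.2.1 s.2.2 cA ∧
      P.Accepts W s.1.2 s.2.1 s.2.2 cB}) ≤ 0 := by
    refine prob_bind_le _ _ _ fun y => prob_bind_le _ _ _ fun g₁ => prob_bind_le _ _ _ fun g₂ =>
      prob_pure_le _ le_rfl ?_
    rintro ⟨h1, h2⟩
    exact h1 ⟨h2.1, h2.2, rfl, rfl, rfl⟩
  have hA := hfar_run (A.openA r) (acc ∩ {s | A.openA r s.2.2.g₁ s.2.2.g₂ ∉ S})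
    (fun s hs => ⟨hs.2, by rw [hs.1.2.2.1]; exact hs.1.1.2.1⟩)
  have hB := hfar_run (A.openB r) (acc ∩ {s | A.openB r s.2.2.g₁ s.2.2.g₂ ∉ S})
    (fun s hs => ⟨hs.2, by rw [hs.1.2.2.2.1]; exact hs.1.2.1.2.1⟩)
  have hAB : prob run (acc ∩ {s | s.1.1 ∈ S ∧ s.1.2 ∈ S}) ≤
      Real.exp (n * (Real.binEntropy W.θ + 2 * P.ν * W.slope)) ^ (4 * n) *
        (2 ^ l₁ / (2 ^ l₁) ^ (4 * n)) + (4 * n) ^ 2 * (2 ^ l₂)⁻¹ := by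
    -- Alice chooses `e₁` after seeing `g₁`, so `g₁` counts as bad as soon as any fibre is large.
    -- For good `g₁` the relevant fibre is fixed before `g₂` is drawn.
    refine prob_bind_le _ _ _ fun y => (prob_bind_le_add _ _
      {g | ∃ e, 4 * n ≤ #{x ∈ S | P.G₁.hash g x = e}} _
      (C := (4 * (n : ℝ)) ^ 2 * (2 ^ l₂)⁻¹) (by positivity) fun g₁ hg₁ => ?_).trans ?_
    · have hcard : #{x ∈ S | P.G₁.hash g₁ x = A.answer₁ r g₁} ≤ 4 * n := by
        by_contra h
        exact hg₁ ⟨_, (not_le.1 h).le⟩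
      refine (prob_bind_le_add _ _
        {g | ∃ x ∈ ({x ∈ S | P.G₁.hash g₁ x = A.answer₁ r g₁} : Finset _),
          ∃ x' ∈ ({x ∈ S | P.G₁.hash g₁ x = A.answer₁ r g₁} : Finset _),
            x ≠ x' ∧ P.G₂.hash g x = P.G₂.hash g x'} _ le_rfl
        fun g₂ hg₂ => prob_pure_le _ le_rfl ?_).trans ?_
      · rintro ⟨⟨⟨-, -, a1, a2, a3⟩, ⟨-, -, b1, b2, b3⟩, -, -, -⟩, hSA, hSB⟩
        refine hg₂ ⟨_, Finset.mem_filter.2 ⟨hSA, a1⟩, _, Finset.mem_filter.2 ⟨hSB, b1⟩, ?_,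
          a2.trans b2.symm⟩
        intro hx
        simp only at a3 b3 hx
        exact hc (by rw [a3, b3, hx])
      · rw [add_zero]
        refine (hG₂.prob_exists_collision_le _).trans ?_
        gcongr
        exact_mod_cast hcard
    · gcongr
      refine (hG₁.prob_large_fibre_le S).trans ?_
      gcongr
      exact W.card_compatible_le _ _ _
  refine (prob_mono _ hsub).trans ((prob_union_le _ _ _).trans ?_)
  have h3 := prob_union_le run (acc ∩ {s | A.openA r s.2.2.g₁ s.2.2.g₂ ∉ S})
    ((acc ∩ {s | A.openB r s.2.2.g₁ s.2.2.g₂ ∉ S}) ∪ (acc ∩ {s | s.1.1 ∈ S ∧ s.1.2 ∈ S}))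
  have h4 := prob_union_le run (acc ∩ {s | A.openB r s.2.2.g₁ s.2.2.g₂ ∉ S})
    (acc ∩ {s | s.1.1 ∈ S ∧ s.1.2 ∈ S})
  linarith

end HashProtocol

end UNC

namespace UNC

open Finset

/-! ### Privacy amplification -/

lemma HashFamily.IsUniversal.card_collision_le {n l : ℕ} {H : HashFamily n l}
    (hH : H.IsUniversal 2) {x x' : Bits n} (hx : x ≠ x') :
    (#{g | H.hash g x = H.hash g x'} : ℝ) ≤ Fintype.card H.Key * (2 ^ l)⁻¹ := by
  have h1 := hH.prob_collision_le hx
  have h2 := prob_uniform ({g | H.hash g x = H.hash g x'} : Finset H.Key)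
  rw [Finset.coe_filter_univ] at h2
  rw [h2, div_le_iff₀ (by exact_mod_cast Fintype.card_pos)] at h1
  linarith

/-- Summing over the values of `(F, f)` against their joint weight is summing over `x`. -/
lemma sum_sum_fibre {X E Z : Type} [Fintype X] [Fintype E] [Fintype Z] [DecidableEq E]
    [DecidableEq Z] (P : X → ℝ) (F : X → E) (f : X → Z) (G : E → Z → ℝ) :
    ∑ e, ∑ z, (∑ x, if F x = e ∧ f x = z then P x else 0) * G e z = ∑ x, P x * G (F x) (f x) := by
  simp only [Finset.sum_mul]
  calc _ = ∑ e, ∑ x, ∑ z, (if F x = e ∧ f x = z then P x else 0) * G e z :=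
        Finset.sum_congr rfl fun e _ => Finset.sum_comm
    _ = ∑ x, ∑ e, ∑ z, (if F x = e ∧ f x = z then P x else 0) * G e z := Finset.sum_comm
    _ = _ := by
      refine Finset.sum_congr rfl fun x _ => ?_
      rw [Finset.sum_eq_single (F x), Finset.sum_eq_single (f x)]
      · simp
      · intro z _ hz
        simp [hz.symm]
      · simp
      · intro e _ he
        simp [he.symm]
      · simp

/-- The average of a concave power is at most the power of the average. -/
lemma sum_rpow_le {K : Type} [Fintype K] [Nonempty K] (u : K → ℝ) (hu : ∀ g, 0 ≤ u g) {s B : ℝ}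
    (hs0 : 0 ≤ s) (hs1 : s ≤ 1) (hB : ∑ g, u g ≤ Fintype.card K * B) :
    ∑ g, u g ^ s ≤ Fintype.card K * B ^ s := by
  have hK : (0 : ℝ) < Fintype.card K := by exact_mod_cast Fintype.card_pos
  have h1 := (Real.concaveOn_rpow hs0 hs1).le_map_sum (t := Finset.univ)
    (w := fun _ : K => (Fintype.card K : ℝ)⁻¹) (p := u) (fun _ _ => by positivity)
    (by simp [hK.ne']) (fun g _ => hu g)
  simp only [smul_eq_mul, ← Finset.mul_sum] at h1
  have h2 : (Fintype.card K : ℝ)⁻¹ * ∑ g, u g ≤ B := by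
    rw [inv_mul_le_iff₀ hK]
    exact hB
  have h3 : 0 ≤ (Fintype.card K : ℝ)⁻¹ * ∑ g, u g :=
    mul_nonneg (by positivity) (Finset.sum_nonneg fun g _ => hu g)
  rw [inv_mul_le_iff₀ hK] at h1
  exact h1.trans (by gcongr)

/-- A form of the leftover hash lemma for Rényi entropies of order `1 + s`, with the side
information `F x`. -/
lemma HashFamily.IsUniversal.sum_rpow_extract_le {n k : ℕ} {H : HashFamily n k}
    (hH : H.IsUniversal 2) {E : Type} [Fintype E] [DecidableEq E] (P : Bits n → ℝ)
    (hP0 : ∀ x, 0 ≤ P x) (hP1 : ∑ x, P x = 1) (F : Bits n → E) {s η : ℝ} (hs0 : 0 < s)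
    (hs1 : s ≤ 1) (hη : 0 < η) :
    ∑ g, ∑ e, ∑ z, (∑ x, if F x = e ∧ H.hash g x = z then P x else 0) *
      ((∑ x, if F x = e ∧ H.hash g x = z then P x else 0) *
        (2 ^ k / ((∑ x, if F x = e then P x else 0) + η / Fintype.card E))) ^ s ≤
    Fintype.card H.Key * (1 + (2 ^ k * Fintype.card E / η) ^ s * ∑ x, P x ^ (1 + s)) := by
  have hE : (0 : ℝ) < Fintype.card E := by
    exact_mod_cast Fintype.card_pos_iff.2 ⟨F fun _ => true⟩
  have hK : (0 : ℝ) < Fintype.card H.Key := by exact_mod_cast Fintype.card_pos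
  set pe : E → ℝ := fun e => ∑ x, if F x = e then P x else 0 with hpe
  set q : H.Key → E → Bits k → ℝ := fun g e z => ∑ x, if F x = e ∧ H.hash g x = z then P x else 0
    with hq
  have hpe0 : ∀ e, 0 ≤ pe e := fun e => Finset.sum_nonneg fun x _ => by
    split_ifs <;> simp [hP0]
  have hq0 : ∀ g e z, 0 ≤ q g e z := fun g e z => Finset.sum_nonneg fun x _ => by
    split_ifs <;> simp [hP0]
  have hden : ∀ e, 0 < pe e + η / Fintype.card E := fun e =>
    add_pos_of_nonneg_of_pos (hpe0 e) (by positivity)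
  change ∑ g, ∑ e, ∑ z, q g e z * (q g e z * (2 ^ k / (pe e + η / Fintype.card E))) ^ s ≤ _
  have e1 : ∀ g, ∑ e, ∑ z, q g e z * (q g e z * (2 ^ k / (pe e + η / Fintype.card E))) ^ s =
      ∑ x, P x * (q g (F x) (H.hash g x) * (2 ^ k / (pe (F x) + η / Fintype.card E))) ^ s :=
    fun g => sum_sum_fibre P F (H.hash g)
      (fun e z => (q g e z * (2 ^ k / (pe e + η / Fintype.card E))) ^ s)
  simp only [e1]
  rw [Finset.sum_comm]
  simp only [← Finset.mul_sum]
  -- Average over `g` of the mass sharing both values with `x`: the string `x` itself contributes `P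
  -- x`, and by 2-universality every other string in the fibre of `F` collides with probability at
  -- most `2 ^ (-k)`.
  have e2 : ∀ x, ∑ g, q g (F x) (H.hash g x) ≤
      Fintype.card H.Key * (P x + (2 ^ k)⁻¹ * pe (F x)) := by
    intro x
    have h1 : ∑ g, q g (F x) (H.hash g x) = ∑ x', if F x' = F x then
        P x' * (#{g | H.hash g x' = H.hash g x} : ℝ) else 0 := by
      simp only [hq]
      rw [Finset.sum_comm]
      refine Finset.sum_congr rfl fun x' _ => ?_
      by_cases h : F x' = F x
      · simp [h, Finset.sum_ite, mul_comm]
      · simp [h]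
    have h2 : ∀ x', (if F x' = F x then P x' * (#{g | H.hash g x' = H.hash g x} : ℝ) else 0) ≤
        (if x' = x then Fintype.card H.Key * P x else 0) +
          Fintype.card H.Key * (2 ^ k)⁻¹ * (if F x' = F x then P x' else 0) := by
      intro x'
      by_cases hx : x' = x
      · subst hx
        simp only [if_true]
        rw [Finset.filter_true, Finset.card_univ, mul_comm]
        have := mul_nonneg (mul_nonneg hK.le (by positivity : (0 : ℝ) ≤ (2 ^ k)⁻¹)) (hP0 x')
        linarith
      · simp only [hx, if_false, zero_add]
        split_ifs
        · rw [mul_comm]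
          exact mul_le_mul_of_nonneg_right (hH.card_collision_le hx) (hP0 x')
        · simp
    rw [h1]
    refine (Finset.sum_le_sum fun x' _ => h2 x').trans (le_of_eq ?_)
    rw [Finset.sum_add_distrib, ← Finset.mul_sum]
    simp only [hpe, Finset.sum_ite_eq', Finset.mem_univ, if_true]
    ring
  -- Jensen moves the average over `g` inside the power `s`, and subadditivity of `u ↦ u ^ s`
  -- separates the collision of `x` with itself from the uniform part.
  have e3 : ∀ x, ∑ g, (q g (F x) (H.hash g x) * (2 ^ k / (pe (F x) + η / Fintype.card E))) ^ s ≤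
      Fintype.card H.Key * ((P x * (2 ^ k * Fintype.card E / η)) ^ s + 1) := by
    intro x
    have hd := hden (F x)
    have hb0 : (0 : ℝ) ≤ P x * (2 ^ k * Fintype.card E / η) := mul_nonneg (hP0 x) (by positivity)
    refine (sum_rpow_le _ (fun g => mul_nonneg (hq0 _ _ _) (by positivity)) hs0.le hs1
      (B := P x * (2 ^ k * Fintype.card E / η) + 1) ?_).trans ?_
    · rw [← Finset.sum_mul]
      calc _ ≤ Fintype.card H.Key * (P x + (2 ^ k)⁻¹ * pe (F x)) *
            (2 ^ k / (pe (F x) + η / Fintype.card E)) := by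
              gcongr
              exact e2 x
        _ = Fintype.card H.Key * (P x * (2 ^ k / (pe (F x) + η / Fintype.card E)) +
              pe (F x) / (pe (F x) + η / Fintype.card E)) := by
              field_simp
        _ ≤ _ := by
              -- The smoothing term `η / |E|` bounds the denominator from below whatever the
              -- probability of the value `F x`; this is where the side information costs a factor
              -- `|E|`.
              have h1 : (2 : ℝ) ^ k / (pe (F x) + η / Fintype.card E) ≤
                  2 ^ k * Fintype.card E / η := by
                rw [← div_div_eq_mul_div]
                gcongr
                linarith [hpe0 (F x)]
              have h2 : pe (F x) / (pe (F x) + η / Fintype.card E) ≤ 1 := by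
                rw [div_le_one hd]
                have : 0 < η / Fintype.card E := by positivity
                linarith
              have h3 := mul_le_mul_of_nonneg_left h1 (hP0 x)
              gcongr
    · gcongr
      have := Real.rpow_add_le_add_rpow hb0 zero_le_one hs0.le hs1
      simpa using this
  calc _ ≤ ∑ x, P x * (Fintype.card H.Key * ((P x * (2 ^ k * Fintype.card E / η)) ^ s + 1)) :=
        Finset.sum_le_sum fun x _ => mul_le_mul_of_nonneg_left (e3 x) (hP0 x)
    _ = ∑ x, (Fintype.card H.Key * P x +
          Fintype.card H.Key * (2 ^ k * Fintype.card E / η) ^ s * P x ^ (1 + s)) := by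
        refine Finset.sum_congr rfl fun x _ => ?_
        have h1 : P x ^ (1 + s) = P x * P x ^ s := by
          rw [Real.rpow_add_of_nonneg (hP0 x) zero_le_one hs0.le, Real.rpow_one]
        rw [Real.mul_rpow (hP0 x) (by positivity), h1]
        ring
    _ = _ := by
        rw [Finset.sum_add_distrib, ← Finset.mul_sum, ← Finset.mul_sum, hP1]
        ring

/-! ### Masking a message with a nearly uniform string -/

lemma bxor_involutive {k : ℕ} (c : Bits k) : Function.Involutive (bxor c) :=
  fun z => HashProtocol.bxor_bxor_cancel_left c z

lemma sum_bxor {k : ℕ} (c : Bits k) (f : Bits k → ℝ) : ∑ d, f (bxor c d) = ∑ z, f z :=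
  Equiv.sum_comp ((bxor_involutive c).toPerm) f

/-- With `m` the probability of the masked view, the posterior `p * q / m` is the product of `p`, `q
* (N / Q)` and `Q / (N * m)`. The logarithms of the last two are bounded by `log u ≤ (u ^ s - 1) /
s` and `log v ≤ v - 1`. Here `Q / N` is a reference weight for `q`. -/
lemma mul_negMulLog_ge {p q m Q N s : ℝ} (hp : 0 ≤ p) (hq : 0 ≤ q) (hm : p * q ≤ m) (hQ : 0 < Q)
    (hN : 0 < N) (hs : 0 < s) :
    q * Real.negMulLog p - p * (q * (q * (N / Q)) ^ s - q) / s - p * q / m * (Q / N) + p * q ≤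
      m * Real.negMulLog (p * q / m) := by
  rcases hp.eq_or_lt with rfl | hp
  · simp
  rcases hq.eq_or_lt with rfl | hq
  · simp
  have hpq : 0 < p * q := mul_pos hp hq
  have hm : 0 < m := hpq.trans_le hm
  have hu : 0 < q * (N / Q) := by positivity
  have hv : 0 < Q / (N * m) := by positivity
  have e1 : m * Real.negMulLog (p * q / m) = -(p * q) *
      (Real.log p + Real.log (q * (N / Q)) + Real.log (Q / (N * m))) := by
    unfold Real.negMulLog
    rw [← Real.log_mul hp.ne' hu.ne', ← Real.log_mul (by positivity) hv.ne']
    have : p * (q * (N / Q)) * (Q / (N * m)) = p * q / m := by field_simp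
    rw [this]
    field_simp
  have h1 : Real.log (q * (N / Q)) ≤ ((q * (N / Q)) ^ s - 1) / s := by
    rw [le_div_iff₀ hs, mul_comm, ← Real.log_rpow hu]
    exact Real.log_le_sub_one_of_pos (by positivity)
  have h2 : Real.log (Q / (N * m)) ≤ Q / (N * m) - 1 := Real.log_le_sub_one_of_pos hv
  rw [e1]
  have h3 := mul_le_mul_of_nonneg_left (add_le_add h1 h2) hpq.le
  have e2 : p * q * (((q * (N / Q)) ^ s - 1) / s + (Q / (N * m) - 1)) =
      p * (q * (q * (N / Q)) ^ s - q) / s + p * q / m * (Q / N) - p * q := by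
    field_simp
    ring
  rw [e2] at h3
  unfold Real.negMulLog
  linarith

/-- If `(j, z)` has law `q`, the message `c` has law `p` and is independent of `(j, z)`, then `c` has
almost full conditional entropy given `j` and the masked message `d = c ⊕ z`, provided that `z` is
almost uniform given `j`. -/
lemma le_sum_negMulLog_mask {k : ℕ} {J : Type} [Fintype J] (p : Bits k → ℝ) (hp0 : ∀ c, 0 ≤ p c)
    (hp1 : ∑ c, p c = 1) (q : J → Bits k → ℝ) (hq0 : ∀ j z, 0 ≤ q j z)
    (hq1 : ∑ j, ∑ z, q j z = 1) (Q : J → ℝ) (hQ : ∀ j, 0 < Q j) {s : ℝ} (hs : 0 < s) :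
    ∑ c, Real.negMulLog (p c) - (∑ j, ∑ z, q j z * (q j z * (2 ^ k / Q j)) ^ s - 1) / s -
        (∑ j, Q j - 1) ≤
      ∑ j, ∑ d, (∑ c, p c * q j (bxor c d)) *
        ∑ c, Real.negMulLog (p c * q j (bxor c d) / ∑ c, p c * q j (bxor c d)) := by
  set m : J → Bits k → ℝ := fun j d => ∑ c, p c * q j (bxor c d) with hm
  -- Only an inequality, since the quotients are `0` when `m j d = 0`.
  have hm1 : ∀ j d, ∑ c, p c * q j (bxor c d) / m j d ≤ 1 := by
    intro j d
    rw [← Finset.sum_div]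
    exact div_self_le_one _
  have hle : ∀ j d c, p c * q j (bxor c d) ≤ m j d := fun j d c =>
    Finset.single_le_sum (f := fun c => p c * q j (bxor c d))
      (fun c _ => mul_nonneg (hp0 c) (hq0 _ _)) (Finset.mem_univ c)
  have hpt := fun j d c => mul_negMulLog_ge (hp0 c) (hq0 j (bxor c d)) (hle j d c) (hQ j)
    (by positivity : (0 : ℝ) < 2 ^ k) hs
  have hsum : ∀ j d, (∑ c, (q j (bxor c d) * Real.negMulLog (p c) -
      p c * (q j (bxor c d) * (q j (bxor c d) * (2 ^ k / Q j)) ^ s - q j (bxor c d)) / s +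
      p c * q j (bxor c d))) - Q j / 2 ^ k ≤
      m j d * ∑ c, Real.negMulLog (p c * q j (bxor c d) / m j d) := by
    intro j d
    have h1 := Finset.sum_le_sum fun c (_ : c ∈ Finset.univ) => hpt j d c
    rw [← Finset.mul_sum] at h1
    refine le_trans ?_ h1
    have h2 : ∑ c, p c * q j (bxor c d) / m j d * (Q j / 2 ^ k) ≤ Q j / 2 ^ k := by
      rw [← Finset.sum_mul]
      exact mul_le_of_le_one_left (div_pos (hQ j) (by positivity)).le (hm1 j d)
    simp only [Finset.sum_add_distrib, Finset.sum_sub_distrib] at h2 ⊢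
    linarith
  refine le_trans (le_of_eq ?_)
    (Finset.sum_le_sum fun j _ => Finset.sum_le_sum fun d _ => hsum j d)
  have swap : ∀ f : J → Bits k → Bits k → ℝ, ∑ j, ∑ d, ∑ c, f j c (bxor c d) =
      ∑ c, ∑ j, ∑ z, f j c z := by
    intro f
    calc _ = ∑ j, ∑ c, ∑ d, f j c (bxor c d) :=
          Finset.sum_congr rfl fun j _ => Finset.sum_comm
      _ = ∑ c, ∑ j, ∑ d, f j c (bxor c d) := Finset.sum_comm
      _ = _ := Finset.sum_congr rfl fun c _ => Finset.sum_congr rfl fun j _ => sum_bxor c _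
  simp only [Finset.sum_sub_distrib]
  rw [swap fun j c z => q j z * Real.negMulLog (p c) -
      p c * (q j z * (q j z * (2 ^ k / Q j)) ^ s - q j z) / s + p c * q j z]
  have e1 : ∀ c, ∑ j, ∑ z, (q j z * Real.negMulLog (p c) -
      p c * (q j z * (q j z * (2 ^ k / Q j)) ^ s - q j z) / s + p c * q j z) =
      Real.negMulLog (p c) -
        p c * ((∑ j, ∑ z, q j z * (q j z * (2 ^ k / Q j)) ^ s - 1) / s) + p c := by
    intro c
    simp only [Finset.sum_add_distrib, Finset.sum_sub_distrib, mul_sub, sub_div,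
      ← Finset.sum_mul, ← Finset.mul_sum, ← Finset.sum_div, hq1]
    ring
  simp only [e1]
  rw [Finset.sum_add_distrib, Finset.sum_sub_distrib, ← Finset.sum_mul, hp1]
  have e2 : ∑ j, ∑ _d : Bits k, Q j / 2 ^ k = ∑ j, Q j := by
    refine Finset.sum_congr rfl fun j _ => ?_
    rw [Finset.sum_const, Finset.card_univ, card_bits, nsmul_eq_mul]
    push_cast
    field_simp
  rw [e2]
  ring

end UNC

namespace UNC

open Finset

/-! ### Mutual information -/

lemma pmf_map_apply_of_injective {α β : Type} (p : PMF α) {f : α → β} (hf : Function.Injective f)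
    (a : α) : p.map f (f a) = p a := by
  rw [PMF.map_apply, tsum_eq_single a]
  · simp
  · intro b hb
    rw [if_neg fun h => hb (hf h).symm]

lemma pmf_map_apply_of_notMem_range {α β : Type} (p : PMF α) {f : α → β} {b : β}
    (hb : b ∉ Set.range f) : p.map f b = 0 := by
  rw [PMF.map_apply, ENNReal.tsum_eq_zero]
  intro a
  rw [if_neg fun h => hb ⟨a, h.symm⟩]

lemma pmf_map_snd_toReal {α β : Type} [Fintype α] (p : PMF (α × β)) (b : β) :
    (p.map Prod.snd b).toReal = ∑ a, (p (a, b)).toReal := by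
  classical
  rw [← ENNReal.toReal_sum fun a _ => p.apply_ne_top _, PMF.map_apply, ENNReal.tsum_prod']
  congr 1
  rw [tsum_fintype]
  refine Finset.sum_congr rfl fun a _ => ?_
  rw [tsum_eq_single b]
  · simp
  · intro b' hb'
    rw [if_neg fun h => hb' h.symm]

/-- Relabelling the view injectively changes neither marginal of `A` nor any nonzero term of the
conditional entropy; values outside the range of `f` contribute `0`. -/
lemma mutualInfo_map {α β β' : Type} [Fintype α] (p : PMF (α × β)) {f : β → β'}
    (hf : Function.Injective f) : mutualInfo (p.map (Prod.map id f)) = mutualInfo p := by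
  have hsnd : (p.map (Prod.map id f)).map Prod.snd = (p.map Prod.snd).map f := by
    rw [PMF.map_comp, PMF.map_comp]
    rfl
  have hfst : (p.map (Prod.map id f)).map Prod.fst = p.map Prod.fst := by
    rw [PMF.map_comp]
    rfl
  have hinj : Function.Injective (Prod.map (id : α → α) f) := Function.injective_id.prodMap hf
  unfold mutualInfo
  rw [hfst]
  congr 1
  unfold condEntropy
  rw [hsnd, ← hf.tsum_eq]
  · refine tsum_congr fun b => ?_
    rw [pmf_map_apply_of_injective _ hf]
    have h1 : ∀ a, p.map (Prod.map id f) (a, f b) = p (a, b) := fun a =>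
      pmf_map_apply_of_injective p hinj (a, b)
    simp only [h1]
  · intro b hb
    by_contra h
    refine hb ?_
    simp only
    rw [pmf_map_apply_of_notMem_range _ h]
    simp

/-- The contribution of the value `b` to the conditional entropy. -/
def condEntropyTerm {α β : Type} [Fintype α] (p : PMF (α × β)) (b : β) : ℝ :=
  (p.map Prod.snd b).toReal *
    ∑ a, Real.negMulLog ((p (a, b)).toReal / (p.map Prod.snd b).toReal) / Real.log 2

lemma condEntropyTerm_nonneg {α β : Type} [Fintype α] (p : PMF (α × β)) (b : β) :
    0 ≤ condEntropyTerm p b := by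
  refine mul_nonneg ENNReal.toReal_nonneg (Finset.sum_nonneg fun a _ =>
    div_nonneg (Real.negMulLog_nonneg (by positivity) ?_) (Real.log_nonneg one_le_two))
  refine div_le_one_of_le₀ ?_ ENNReal.toReal_nonneg
  rw [pmf_map_snd_toReal]
  exact Finset.single_le_sum (f := fun a => (p (a, b)).toReal) (fun a _ => ENNReal.toReal_nonneg)
    (Finset.mem_univ a)

lemma pmf_summable_toReal {α : Type} (p : PMF α) : Summable fun a => (p a).toReal :=
  ENNReal.summable_toReal p.tsum_coe_ne_top

lemma pmf_tsum_toReal {α : Type} (p : PMF α) : ∑' a, (p a).toReal = 1 := by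
  rw [← ENNReal.tsum_toReal_eq fun a => p.apply_ne_top a, p.tsum_coe, ENNReal.toReal_one]

lemma summable_condEntropyTerm {α β : Type} [Fintype α] (p : PMF (α × β)) :
    Summable (condEntropyTerm p) := by
  refine Summable.of_nonneg_of_le (condEntropyTerm_nonneg p) (fun b => ?_)
    ((pmf_summable_toReal (p.map Prod.snd)).mul_right (∑ _a : α, 1 / Real.log 2))
  unfold condEntropyTerm
  have h2 : 0 < Real.log 2 := Real.log_pos one_lt_two
  gcongr with a
  refine (Real.negMulLog_le_one_sub_self (by positivity)).trans ?_
  have : 0 ≤ (p (a, b)).toReal / (p.map Prod.snd b).toReal := by positivity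
  linarith

/-- The coins range over an arbitrary type, so the conditional entropy is a genuine series. It is
summed coin by coin, each bound being weighted by the probability of the coin. -/
lemma le_condEntropy {α R D : Type} [Fintype α] [Fintype D] (p : PMF (α × (R × D)))
    (coins : PMF R) (c : ℝ)
    (hc : ∀ r, (coins r).toReal * c ≤ ∑ d, condEntropyTerm p (r, d)) : c ≤ condEntropy p := by
  have hs := summable_condEntropyTerm p
  change c ≤ ∑' b, condEntropyTerm p b
  rw [hs.tsum_prod]
  calc c = ∑' r, (coins r).toReal * c := by rw [tsum_mul_right, pmf_tsum_toReal, one_mul]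
    _ ≤ _ := by
      refine Summable.tsum_le_tsum (fun r => ?_) ((pmf_summable_toReal coins).mul_right c) hs.prod
      rw [tsum_fintype]
      exact hc r

/-- The law of `(c, (r, (j, c ⊕ z)))` for a message `c` and independent coins `r`, where `(j, z)`
has law `base r`. -/
def maskLaw {k : ℕ} {R J : Type} (pC : PMF (Bits k)) (coins : PMF R)
    (base : R → PMF (J × Bits k)) : PMF (Bits k × (R × (J × Bits k))) :=
  pC.bind fun c => coins.bind fun r => (base r).map fun jz => (c, (r, (jz.1, bxor c jz.2)))

lemma maskLaw_apply {k : ℕ} {R J : Type} (pC : PMF (Bits k)) (coins : PMF R)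
    (base : R → PMF (J × Bits k)) (c : Bits k) (r : R) (j : J) (d : Bits k) :
    maskLaw pC coins base (c, (r, (j, d))) = pC c * (coins r * base r (j, bxor c d)) := by
  unfold maskLaw
  rw [PMF.bind_apply, tsum_eq_single c, PMF.bind_apply, tsum_eq_single r]
  · congr 2
    have hinj : Function.Injective
        (fun jz : J × Bits k => ((c, (r, (jz.1, bxor c jz.2))) : Bits k × (R × (J × Bits k)))) := by
      rintro ⟨j, z⟩ ⟨j', z'⟩ h
      simp only [Prod.mk.injEq, true_and] at h
      exact Prod.ext h.1 ((bxor_involutive c).injective h.2)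
    have h1 := pmf_map_apply_of_injective (base r) hinj (j, bxor c d)
    simp only [HashProtocol.bxor_bxor_cancel_left] at h1
    exact h1
  · intro r' hr'
    rw [pmf_map_apply_of_notMem_range, mul_zero]
    rintro ⟨jz, h⟩
    simp only [Prod.mk.injEq] at h
    exact hr' h.2.1
  · intro c' hc'
    rw [PMF.bind_apply, ENNReal.tsum_eq_zero.2, mul_zero]
    intro r'
    rw [pmf_map_apply_of_notMem_range, mul_zero]
    rintro ⟨jz, h⟩
    simp only [Prod.mk.injEq] at h
    exact hc' h.1

lemma map_fst_maskLaw {k : ℕ} {R J : Type} (pC : PMF (Bits k)) (coins : PMF R)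
    (base : R → PMF (J × Bits k)) : (maskLaw pC coins base).map Prod.fst = pC := by
  unfold maskLaw
  rw [PMF.map_bind]
  simp only [PMF.map_bind, PMF.map_comp]
  have h1 : ∀ (c : Bits k) (r : R), (base r).map (Prod.fst ∘ fun jz : J × Bits k =>
      ((c, (r, (jz.1, bxor c jz.2))) : Bits k × (R × (J × Bits k)))) = PMF.pure c :=
    fun c r => PMF.map_const (base r) c
  simp only [h1, PMF.bind_const, PMF.bind_pure]

/-- A masked message is nearly independent of the view if the mask is nearly uniform. -/
lemma mutualInfo_maskLaw_le {k : ℕ} {R J : Type} [Fintype J] (pC : PMF (Bits k)) (coins : PMF R)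
    (base : R → PMF (J × Bits k)) {s η B : ℝ} (hs : 0 < s)
    (hbase : ∀ r, ∃ Q : J → ℝ, (∀ j, 0 < Q j) ∧ ∑ j, Q j ≤ 1 + η ∧
      ∑ j, ∑ z, (base r (j, z)).toReal * ((base r (j, z)).toReal * (2 ^ k / Q j)) ^ s ≤ 1 + B) :
    mutualInfo (maskLaw pC coins base) ≤ (η + B / s) / Real.log 2 := by
  have h2 : 0 < Real.log 2 := Real.log_pos one_lt_two
  unfold mutualInfo
  rw [map_fst_maskLaw]
  have key : (∑ c, Real.negMulLog (pC c).toReal - B / s - η) / Real.log 2 ≤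
      condEntropy (maskLaw pC coins base) := by
    refine le_condEntropy _ coins _ fun r => ?_
    obtain ⟨Q, hQ0, hQ1, hB⟩ := hbase r
    set ρ := (coins r).toReal with hρ
    set q : J → Bits k → ℝ := fun j z => (base r (j, z)).toReal with hq
    set p : Bits k → ℝ := fun c => (pC c).toReal with hp
    have hjoint : ∀ c j d, (maskLaw pC coins base (c, (r, (j, d)))).toReal =
        ρ * (p c * q j (bxor c d)) := by
      intro c j d
      rw [maskLaw_apply, ENNReal.toReal_mul, ENNReal.toReal_mul]
      simp only [hp, hq, hρ]
      ring
    have hmarg : ∀ j d, ((maskLaw pC coins base).map Prod.snd (r, (j, d))).toReal =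
        ρ * ∑ c, p c * q j (bxor c d) := by
      intro j d
      rw [pmf_map_snd_toReal, Finset.mul_sum]
      exact Finset.sum_congr rfl fun c _ => hjoint c j d
    have hterm : ∀ j d, condEntropyTerm (maskLaw pC coins base) (r, (j, d)) =
        ρ * (((∑ c, p c * q j (bxor c d)) *
          ∑ c, Real.negMulLog (p c * q j (bxor c d) / ∑ c, p c * q j (bxor c d))) /
            Real.log 2) := by
      intro j d
      unfold condEntropyTerm
      rw [hmarg]
      simp only [hjoint]
      -- The weight of the coin cancels in the posterior unless it is zero, and then both sides
      -- vanish.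
      rcases eq_or_ne ρ 0 with h0 | h0
      · simp [h0]
      · simp only [mul_div_mul_left _ _ h0]
        rw [← Finset.sum_div]
        ring
    rw [Fintype.sum_prod_type]
    simp only [hterm, ← Finset.mul_sum, ← Finset.sum_div]
    have h3 := le_sum_negMulLog_mask p (fun c => ENNReal.toReal_nonneg) (sum_toReal_eq_one pC) q
      (fun j z => ENNReal.toReal_nonneg)
      (by rw [← Fintype.sum_prod_type' fun j z => q j z]; exact sum_toReal_eq_one (base r)) Q hQ0 hs
    have hρ0 : 0 ≤ ρ := ENNReal.toReal_nonneg
    gcongr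
    refine le_trans ?_ h3
    have h4 : (∑ j, ∑ z, q j z * (q j z * (2 ^ k / Q j)) ^ s - 1) / s ≤ B / s := by
      gcongr
      linarith
    linarith
  have e1 : entropy pC = (∑ c, Real.negMulLog (pC c).toReal) / Real.log 2 := by
    unfold entropy
    rw [Finset.sum_div]
  rw [e1]
  have e2 : (∑ c, Real.negMulLog (pC c).toReal - B / s - η) / Real.log 2 =
      (∑ c, Real.negMulLog (pC c).toReal) / Real.log 2 - (η + B / s) / Real.log 2 := by
    ring
  linarith

/-! ### Concealment -/

/-- The sum factorises over the coordinates, and `t ^ (1 + s) + (1 - t) ^ (1 + s)` is convex and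
symmetric, hence largest at `t = γ`. -/
lemma sum_toReal_prod_rpow_le (W : UnfairNoisyChannel) {n : ℕ} (t : Fin n → W.Crossover)
    (y : Bits n) {s : ℝ} (hs : 0 < s) :
    ∑ x : Bits n, (∏ i, (W.useOnce (t i) (x i) (y i)).toReal) ^ (1 + s) ≤
      (W.γ ^ (1 + s) + (1 - W.γ) ^ (1 + s)) ^ n := by
  have e1 : ∀ x : Bits n, (∏ i, (W.useOnce (t i) (x i) (y i)).toReal) ^ (1 + s) =
      ∏ i, (W.useOnce (t i) (x i) (y i)).toReal ^ (1 + s) := fun x =>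
    (Real.finsetProd_rpow _ _ (fun i _ => ENNReal.toReal_nonneg) _).symm
  simp only [e1]
  rw [sum_prod_bits fun i b => (W.useOnce (t i) b (y i)).toReal ^ (1 + s)]
  have hγ : (0 : ℝ) ≤ 1 - W.γ := by linarith [W.γ_lt_δ, W.δ_lt_half]
  have hconv : ConvexOn ℝ (Set.Icc (0 : ℝ) 1) (fun t : ℝ => t ^ (1 + s) + (1 - t) ^ (1 + s)) := by
    have h1 : ConvexOn ℝ (Set.Icc (0 : ℝ) 1) (fun t : ℝ => t ^ (1 + s)) :=
      (convexOn_rpow (by linarith)).subset (fun t ht => ht.1) (convex_Icc _ _)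
    refine h1.add ⟨convex_Icc _ _, fun x hx y hy a b ha hb hab => ?_⟩
    have h2 := h1.2 (x := 1 - x) ⟨by linarith [hx.2], by linarith [hx.1]⟩ (y := 1 - y)
      ⟨by linarith [hy.2], by linarith [hy.1]⟩ ha hb hab
    simp only [smul_eq_mul] at h2 ⊢
    have e2 : 1 - (a * x + b * y) = a * (1 - x) + b * (1 - y) := by linear_combination -hab
    rw [e2]
    exact h2
  calc _ ≤ ∏ _i : Fin n, (W.γ ^ (1 + s) + (1 - W.γ) ^ (1 + s)) := by
        refine Finset.prod_le_prod (fun i _ => by positivity) fun i _ => ?_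
        have h1 := ConvexOn.le_of_symm hconv (fun t => by ring_nf) W.γ_pos.le (t i).2.1
          (by linarith [(t i).2.2, W.δ_lt_half])
        refine le_trans (le_of_eq ?_) h1
        simp only [UnfairNoisyChannel.useOnce_toReal]
        cases y i <;> simp [add_comm]
    _ = _ := by simp

/-- The channel is symmetric, so for a fixed output the transition probabilities also sum to `1`
over the inputs: they are the posterior law of a uniform input. -/
lemma sum_toReal_prod_eq_one (W : UnfairNoisyChannel) {n : ℕ} (t : Fin n → W.Crossover)
    (y : Bits n) : ∑ x : Bits n, ∏ i, (W.useOnce (t i) (x i) (y i)).toReal = 1 := by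
  rw [sum_prod_bits fun i b => (W.useOnce (t i) b (y i)).toReal]
  refine Finset.prod_eq_one fun i _ => ?_
  simp only [UnfairNoisyChannel.useOnce_toReal]
  cases y i <;> simp

namespace HashProtocol

variable {n l₁ l₂ k : ℕ} (P : HashProtocol n l₁ l₂ k) (W : UnfairNoisyChannel)

/-- The hash values that a dishonest Bob with coins `r` who received `y` learns about `x`. -/
def learned (B : P.DishonestBob W) (r : B.R) (y x : Bits n) : Bits l₁ × Bits l₂ :=
  (P.G₁.hash (B.challenge₁ r y) x,
    P.G₂.hash (B.challenge₂ r y (P.G₁.hash (B.challenge₁ r y) x)) x)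

/-- For coins `r` of a dishonest Bob, the joint law of the received string, the hash values, the
extractor, and the extracted string. -/
def extractLaw (B : P.DishonestBob W) (r : B.R) :
    PMF ((Bits n × (Bits l₁ × Bits l₂) × P.Ext.Key) × Bits k) :=
  (PMF.uniformOfFintype (Bits n)).bind fun x => (W.transmit (B.crossover r) n x).bind fun y =>
    (PMF.uniformOfFintype P.Ext.Key).bind fun g =>
      PMF.pure ((y, P.learned W B r y x, g), P.Ext.hash g x)

/-- The view of a dishonest Bob, from its independent parts. -/
def mkView (B : P.DishonestBob W)
    (v : B.R × ((Bits n × (Bits l₁ × Bits l₂) × P.Ext.Key) × Bits k)) : P.View W B :=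
  (v.1, v.2.1.1,
    { g₁ := B.challenge₁ v.1 v.2.1.1
      e₁ := v.2.1.2.1.1
      g₂ := B.challenge₂ v.1 v.2.1.1 v.2.1.2.1.1
      d := v.2.2
      e₂ := v.2.1.2.1.2
      ext := v.2.1.2.2 })

lemma mkView_injective (B : P.DishonestBob W) : Function.Injective (P.mkView W B) := by
  rintro ⟨r, ⟨y, ⟨e₁, e₂⟩, g⟩, d⟩ ⟨r', ⟨y', ⟨e₁', e₂'⟩, g'⟩, d'⟩ h
  simp only [mkView, Prod.mk.injEq, Transcript.mk.injEq] at h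
  obtain ⟨rfl, rfl, -, rfl, -, rfl, rfl, rfl⟩ := h
  rfl

/-- Bob's challenges are functions of his coins, `y` and `e₁`, so the view is an injective
relabelling of data independent of `c`, together with the masked message. -/
lemma bobRun_eq (B : P.DishonestBob W) (pC : PMF (Bits k)) :
    P.bobRun W B pC =
      (maskLaw pC B.coins (P.extractLaw W B)).map (Prod.map id (P.mkView W B)) := by
  unfold bobRun maskLaw extractLaw
  simp only [monad_bind_eq_bind, PMF.map_bind, PMF.pure_map]
  rfl

lemma extractLaw_toReal (B : P.DishonestBob W) (r : B.R) (y : Bits n) (e : Bits l₁ × Bits l₂)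
    (g : P.Ext.Key) (z : Bits k) :
    (P.extractLaw W B r ((y, e, g), z)).toReal = ((2 : ℝ) ^ n)⁻¹ * (Fintype.card P.Ext.Key : ℝ)⁻¹ *
      ∑ x, if P.learned W B r y x = e ∧ P.Ext.hash g x = z then
        (W.transmit (B.crossover r) n x y).toReal else 0 := by
  classical
  unfold extractLaw
  rw [PMF.bind_apply, tsum_fintype, ENNReal.toReal_sum fun x _ =>
    ENNReal.mul_ne_top (PMF.apply_ne_top _ _) (PMF.apply_ne_top _ _), Finset.mul_sum]
  refine Finset.sum_congr rfl fun x _ => ?_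
  rw [ENNReal.toReal_mul, uniform_toReal, card_bits, PMF.bind_apply, tsum_eq_single y]
  · rw [PMF.bind_apply, tsum_eq_single g]
    · rw [PMF.pure_apply]
      have h1 : (((y, e, g), z) : (Bits n × (Bits l₁ × Bits l₂) × P.Ext.Key) × Bits k) =
          ((y, P.learned W B r y x, g), P.Ext.hash g x) ↔
          P.learned W B r y x = e ∧ P.Ext.hash g x = z := by
        simp [eq_comm]
      simp only [h1, ENNReal.toReal_mul, uniform_toReal]
      split_ifs
      · simp
        ring
      · simp
    · intro g' hg'
      rw [PMF.pure_apply, if_neg, mul_zero]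
      simp [hg'.symm]
  · intro y' hy'
    rw [PMF.bind_apply, ENNReal.tsum_eq_zero.2, mul_zero]
    intro g'
    rw [PMF.pure_apply, if_neg, mul_zero]
    simp [hy'.symm]

lemma concealing_of_isUniversal (hExt : P.Ext.IsUniversal 2) {s η : ℝ} (hs0 : 0 < s) (hs1 : s ≤ 1)
    (hη : 0 < η) :
    P.Concealing W ((η + ((2 ^ k * (2 ^ l₁ * 2 ^ l₂) / η) ^ s *
      (W.γ ^ (1 + s) + (1 - W.γ) ^ (1 + s)) ^ n) / s) / Real.log 2) := by
  classical
  intro pC B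
  rw [bobRun_eq, mutualInfo_map _ (P.mkView_injective W B)]
  refine mutualInfo_maskLaw_le pC B.coins _ hs0 fun r => ?_
  have hK : (0 : ℝ) < Fintype.card P.Ext.Key := by exact_mod_cast Fintype.card_pos
  have hE : (Fintype.card (Bits l₁ × Bits l₂) : ℝ) = 2 ^ l₁ * 2 ^ l₂ := by simp
  have hE0 : (0 : ℝ) < Fintype.card (Bits l₁ × Bits l₂) := by rw [hE]; positivity
  choose t ht using fun y => W.exists_transmit_eq_prod (B.crossover r) n y
  set A : Bits n → Bits n → ℝ := fun y x => (W.transmit (B.crossover r) n x y).toReal with hA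
  have hA0 : ∀ y x, 0 ≤ A y x := fun y x => ENNReal.toReal_nonneg
  have hA1 : ∀ y, ∑ x, A y x = 1 := fun y => by
    simp only [hA, ht]
    exact sum_toReal_prod_eq_one W (t y) y
  have hA2 : ∀ y, ∑ x, A y x ^ (1 + s) ≤ (W.γ ^ (1 + s) + (1 - W.γ) ^ (1 + s)) ^ n := fun y => by
    simp only [hA, ht]
    exact sum_toReal_prod_rpow_le W (t y) y hs0
  set pe : Bits n → Bits l₁ × Bits l₂ → ℝ :=
    fun y e => ∑ x, if P.learned W B r y x = e then A y x else 0 with hpe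
  have hpe0 : ∀ y e, 0 ≤ pe y e := fun y e => Finset.sum_nonneg fun x _ => by
    split_ifs <;> simp [hA0]
  have hpe1 : ∀ y, ∑ e, pe y e = 1 := by
    intro y
    simp only [hpe]
    rw [Finset.sum_comm]
    simpa using hA1 y
  set N : ℝ := ((2 : ℝ) ^ n)⁻¹ * (Fintype.card P.Ext.Key : ℝ)⁻¹ with hN
  have hN0 : 0 < N := by positivity
  have hden : ∀ y e, 0 < pe y e + η / Fintype.card (Bits l₁ × Bits l₂) := fun y e =>
    add_pos_of_nonneg_of_pos (hpe0 y e) (by positivity)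
  have hsumN : ∑ _y : Bits n, N * Fintype.card P.Ext.Key = 1 := by
    rw [Finset.sum_const, Finset.card_univ, card_bits, nsmul_eq_mul, hN]
    push_cast
    field_simp
  -- The reference weights are the law of `(y, e, g)` with `e` smoothed by `η / |E|`; their total is
  -- `1 + η`.
  refine ⟨fun j => N * (pe j.1 j.2.1 + η / Fintype.card (Bits l₁ × Bits l₂)),
    fun j => mul_pos hN0 (hden _ _), le_of_eq ?_, ?_⟩
  · rw [Fintype.sum_prod_type]
    simp only [Fintype.sum_prod_type (α₁ := Bits l₁ × Bits l₂), ← Finset.mul_sum,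
      Finset.sum_const, Finset.card_univ, nsmul_eq_mul, Finset.sum_add_distrib, hpe1]
    rw [← mul_assoc]
    have e1 : (Fintype.card (Bits l₁ × Bits l₂) : ℝ) * (η / Fintype.card (Bits l₁ × Bits l₂)) = η := by
      field_simp
    rw [Finset.sum_const, Finset.card_univ, nsmul_eq_mul] at hsumN
    rw [e1]
    linear_combination (1 + η) * hsumN
  · have e1 : ∀ y e g z, (P.extractLaw W B r ((y, e, g), z)).toReal *
        ((P.extractLaw W B r ((y, e, g), z)).toReal *
          (2 ^ k / (N * (pe y e + η / Fintype.card (Bits l₁ × Bits l₂))))) ^ s =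
        N * ((∑ x, if P.learned W B r y x = e ∧ P.Ext.hash g x = z then A y x else 0) *
        ((∑ x, if P.learned W B r y x = e ∧ P.Ext.hash g x = z then A y x else 0) *
          (2 ^ k / (pe y e + η / Fintype.card (Bits l₁ × Bits l₂)))) ^ s) := by
      intro y e g z
      have hd := hden y e
      rw [extractLaw_toReal, ← hN, mul_assoc N, mul_assoc N]
      congr 3
      field_simp
      rfl
    rw [Fintype.sum_prod_type]
    simp only [Fintype.sum_prod_type (α₁ := Bits l₁ × Bits l₂), e1, ← Finset.mul_sum]
    have hmain : ∀ y, ∑ e, ∑ g, ∑ z,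
        (∑ x, if P.learned W B r y x = e ∧ P.Ext.hash g x = z then A y x else 0) *
        ((∑ x, if P.learned W B r y x = e ∧ P.Ext.hash g x = z then A y x else 0) *
          (2 ^ k / (pe y e + η / Fintype.card (Bits l₁ × Bits l₂)))) ^ s ≤
        Fintype.card P.Ext.Key * (1 + (2 ^ k * (2 ^ l₁ * 2 ^ l₂) / η) ^ s *
          (W.γ ^ (1 + s) + (1 - W.γ) ^ (1 + s)) ^ n) := by
      intro y
      rw [Finset.sum_comm]
      refine (hExt.sum_rpow_extract_le (A y) (hA0 y) (hA1 y) (P.learned W B r y) hs0 hs1 hη).trans ?_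
      rw [hE]
      gcongr
      exact hA2 y
    calc _ ≤ N * ∑ _y : Bits n, (Fintype.card P.Ext.Key *
          (1 + (2 ^ k * (2 ^ l₁ * 2 ^ l₂) / η) ^ s *
            (W.γ ^ (1 + s) + (1 - W.γ) ^ (1 + s)) ^ n)) := by
          gcongr with y
          exact hmain y
      _ = _ := by
          rw [Finset.sum_const, nsmul_eq_mul] at hsumN ⊢
          linear_combination (1 + (2 ^ k * (2 ^ l₁ * 2 ^ l₂) / η) ^ s *
            (W.γ ^ (1 + s) + (1 - W.γ) ^ (1 + s)) ^ n) * hsumN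

end HashProtocol

end UNC

namespace UNC

open Finset Filter Topology

/-! ### Existence of universal classes -/

/-- The class of all functions. -/
def HashFamily.all (n l : ℕ) : HashFamily n l where
  Key := Bits n → Bits l
  hash := fun f => f

lemma map_comp_uniformOfFintype {X Z : Type} [Fintype X] [DecidableEq X] [Fintype Z] [Nonempty Z]
    {t : ℕ} (x : Fin t → X) (hx : Function.Injective x) :
    (PMF.uniformOfFintype (X → Z)).map (fun f i => f (x i)) =
      PMF.uniformOfFintype (Fin t → Z) := by
  classical
  refine PMF.ext fun v => (ENNReal.toReal_eq_toReal_iff' (PMF.apply_ne_top _ _)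
    (PMF.apply_ne_top _ _)).1 ?_
  have h1 : ∀ (p : PMF (Fin t → Z)), (p v).toReal = prob p {v} := fun p => by
    unfold prob
    rw [PMF.toOuterMeasure_apply_singleton]
  rw [uniform_toReal, h1, prob_map]
  -- The functions with prescribed values on the `t` points form a box: one choice at each of these
  -- points, all of `Z` elsewhere.
  set S : X → Finset Z := fun b => if h : ∃ i, x i = b then {v h.choose} else Finset.univ with hS
  have h2 : (fun (f : X → Z) i => f (x i)) ⁻¹' {v} =
      ((Fintype.piFinset S : Finset (X → Z)) : Set (X → Z)) := by
    ext f
    rw [Set.mem_preimage, Set.mem_singleton_iff, Finset.mem_coe, Fintype.mem_piFinset]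
    constructor
    · intro h b
      simp only [hS]
      split_ifs with hb
      · rw [Finset.mem_singleton, ← h]
        exact congrArg f hb.choose_spec.symm
      · exact Finset.mem_univ _
    · intro h
      funext i
      have h3 := h (x i)
      have h4 : ∃ j, x j = x i := ⟨i, rfl⟩
      simp only [hS] at h3
      rw [dif_pos h4, Finset.mem_singleton, hx h4.choose_spec] at h3
      exact h3
  rw [h2, prob_uniform]
  have h3 : ∀ b, #(S b) = if b ∈ Finset.univ.image x then 1 else Fintype.card Z := by
    intro b
    simp only [hS, Finset.mem_image, Finset.mem_univ, true_and]
    split_ifs <;> simp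
  have h4 : #(Finset.univ.image x) = t := by
    rw [Finset.card_image_of_injective _ hx, Finset.card_univ, Fintype.card_fin]
  have h5 : t + #({b | b ∉ Finset.univ.image x} : Finset X) = Fintype.card X := by
    have h6 := Finset.card_filter_add_card_filter_not (s := Finset.univ)
      (p := fun b => b ∈ Finset.univ.image x)
    rwa [Finset.filter_univ_mem, h4, Finset.card_univ] at h6
  have h6 : (Fintype.card (X → Z) : ℝ) = (Fintype.card Z : ℝ) ^ t *
      (Fintype.card Z : ℝ) ^ #({b | b ∉ Finset.univ.image x} : Finset X) := by
    rw [← pow_add, h5]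
    simp
  have h7 : (Fintype.card (Fin t → Z) : ℝ) = (Fintype.card Z : ℝ) ^ t := by simp
  have hZ : (Fintype.card Z : ℝ) ≠ 0 := by exact_mod_cast Fintype.card_ne_zero
  rw [h6, h7, Fintype.card_piFinset]
  simp only [h3, Finset.prod_ite, Finset.prod_const_one, Finset.prod_const, one_mul]
  push_cast
  field_simp

lemma HashFamily.all_isUniversal (n l t : ℕ) : (HashFamily.all n l).IsUniversal t :=
  fun x hx => map_comp_uniformOfFintype x hx

/-! ### Asymptotics -/

lemma negligible_exp {a : ℝ} (ha : 0 < a) : Negligible fun n => Real.exp (-a * n) := by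
  intro m
  have h1 := ((Real.tendsto_pow_mul_exp_neg_atTop_nhds_zero m).comp
    (tendsto_natCast_atTop_atTop.const_mul_atTop ha)).const_mul ((a ^ m)⁻¹)
  rw [mul_zero] at h1
  refine h1.congr fun n => ?_
  simp only [Function.comp_apply]
  rw [mul_pow, neg_mul]
  have : a ^ m ≠ 0 := by positivity
  field_simp

/-- The power sum is `1` at `s = 0` with derivative `-binEntropy γ`, so for small `s > 0` it is at
most `1 + s * (κ - binEntropy γ)`. -/
lemma exists_rpow_add_rpow_le {γ : ℝ} (h0 : 0 < γ) (h1 : γ < 1) {κ : ℝ} (hκ : 0 < κ) :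
    ∃ s : ℝ, 0 < s ∧ s ≤ 1 ∧
      γ ^ (1 + s) + (1 - γ) ^ (1 + s) ≤ Real.exp (s * (κ - Real.binEntropy γ)) := by
  have h1' : 0 < 1 - γ := by linarith
  have hd : HasDerivAt (fun s : ℝ => γ ^ (1 + s) + (1 - γ) ^ (1 + s)) (-Real.binEntropy γ) 0 := by
    have e1 := ((hasDerivAt_id (0 : ℝ)).const_add 1).const_rpow h0
    have e2 := ((hasDerivAt_id (0 : ℝ)).const_add 1).const_rpow h1'
    refine (e1.add e2).congr_deriv ?_
    rw [Real.binEntropy_eq_negMulLog_add_negMulLog_one_sub]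
    unfold Real.negMulLog
    simp
    ring
  have h2 := hd.tendsto_slope_zero_right
  have h3 : ∀ᶠ s in 𝓝[>] (0 : ℝ), s⁻¹ • ((γ ^ (1 + (0 + s)) + (1 - γ) ^ (1 + (0 + s))) -
      (γ ^ (1 + (0 : ℝ)) + (1 - γ) ^ (1 + (0 : ℝ)))) < κ - Real.binEntropy γ :=
    h2.eventually (gt_mem_nhds (by linarith))
  have h4 : ∀ᶠ s in 𝓝[>] (0 : ℝ), s ∈ Set.Ioc (0 : ℝ) 1 := Ioc_mem_nhdsGT one_pos
  obtain ⟨s, hs, hs0, hs1⟩ := (h3.and h4).exists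
  refine ⟨s, hs0, hs1, ?_⟩
  rw [smul_eq_mul, inv_mul_lt_iff₀ hs0] at hs
  simp only [zero_add, add_zero, Real.rpow_one] at hs
  have h5 := Real.add_one_le_exp (s * (κ - Real.binEntropy γ))
  linarith

lemma h_mul_log_two (x : ℝ) : h x * Real.log 2 = Real.binEntropy x := by
  unfold h
  have h2 : Real.log 2 ≠ 0 := (Real.log_pos one_lt_two).ne'
  field_simp

lemma two_pow_eq_exp (l : ℕ) : (2 : ℝ) ^ l = Real.exp (l * Real.log 2) := by
  rw [Real.exp_nat_mul, Real.exp_log two_pos]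

namespace HashProtocol

variable {n l₁ l₂ k : ℕ} {P : HashProtocol n l₁ l₂ k} {W : UnfairNoisyChannel}

lemma Sound.mono {ε ε' : ℝ} (hP : P.Sound W ε) (hε : ε ≤ ε') : P.Sound W ε' :=
  fun t c => le_trans (by linarith) (hP t c)

lemma Concealing.mono {ε ε' : ℝ} (hP : P.Concealing W ε) (hε : ε ≤ ε') : P.Concealing W ε' :=
  fun pC B => (hP pC B).trans hε

lemma Binding.mono {ε ε' : ℝ} (hP : P.Binding W ε) (hε : ε ≤ ε') : P.Binding W ε' :=
  fun cA cB hc A => (hP cA cB hc A).trans hε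

end HashProtocol

/-- Of the entropy gap `Δ`, a quarter pays for the smoothing `η = exp (-(Δ / 4) * n)` and a quarter
for passing from Shannon to Rényi entropy; half remains as decay rate. -/
lemma concealment_bound {n k l₁ l₂ : ℕ} {H γ s Δ : ℝ} (h0 : 0 < γ) (h1 : γ < 1) (hs : 0 < s)
    (hlen : (k + l₁ + l₂) * Real.log 2 ≤ n * (H - Δ) + 3 * Real.log 2)
    (hφ : γ ^ (1 + s) + (1 - γ) ^ (1 + s) ≤ Real.exp (s * (Δ / 4 - H))) :
    (2 ^ k * (2 ^ l₁ * 2 ^ l₂) / Real.exp (-(Δ / 4) * n)) ^ s *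
      (γ ^ (1 + s) + (1 - γ) ^ (1 + s)) ^ n ≤
    Real.exp (3 * s * Real.log 2) * Real.exp (-(s * Δ / 2) * n) := by
  have h1' : 0 < 1 - γ := by linarith
  rw [two_pow_eq_exp, two_pow_eq_exp, two_pow_eq_exp, ← Real.exp_add, ← Real.exp_add,
    ← Real.exp_sub, ← Real.exp_mul]
  calc _ ≤ Real.exp ((k * Real.log 2 + (l₁ * Real.log 2 + l₂ * Real.log 2) - -(Δ / 4) * n) * s) *
        Real.exp (s * (Δ / 4 - H)) ^ n := by
        gcongr
    _ ≤ _ := by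
        rw [← Real.exp_nat_mul, ← Real.exp_add, ← Real.exp_add, Real.exp_le_exp]
        have := mul_le_mul_of_nonneg_left hlen hs.le
        linarith

/-- The `4n`-th power turns a linear margin in the length of the hash into `-2 * α * n ^ 2`, which
absorbs all linear terms; completing the square gives the constant. -/
lemma large_fibre_bound {n l : ℕ} {H α c : ℝ} (hα : 0 < α) (hc : c ≤ α / 2)
    (hl : n * (H + α) ≤ l * Real.log 2) (hl' : l * Real.log 2 ≤ n * (H + α) + Real.log 2) :
    Real.exp (n * (H + c)) ^ (4 * n) * (2 ^ l / (2 ^ l) ^ (4 * n)) ≤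
      Real.exp ((H + α + 1) ^ 2 / (8 * α) + Real.log 2) * Real.exp (-1 * n) := by
  rw [two_pow_eq_exp, ← Real.exp_nat_mul, ← Real.exp_nat_mul, ← Real.exp_sub, ← Real.exp_add,
    ← Real.exp_add, Real.exp_le_exp]
  have hn : (0 : ℝ) ≤ n := Nat.cast_nonneg n
  push_cast
  have h1 : 4 * (n : ℝ) * (n * (H + α)) ≤ 4 * n * (l * Real.log 2) := by gcongr
  have h2 : (n : ℝ) * n * c ≤ n * n * (α / 2) := by gcongr
  have h3 : (H + α + 1) * n - 2 * α * n ^ 2 ≤ (H + α + 1) ^ 2 / (8 * α) := by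
    rw [le_div_iff₀ (by positivity)]
    nlinarith [sq_nonneg (H + α + 1 - 4 * α * n)]
  linarith

end UNC

end

/-! ### Choice of the parameters and conclusion -/

theorem theorem2 (W : UnfairNoisyChannel) (β α₁ α₂ : ℝ)
    (hβ_pos : 0 < β) (hβ_lt : β < UNC.h W.γ - UNC.h W.θ)
    (hα₁ : 0 < α₁) (hα₂ : 0 < α₂) (hα : α₁ + α₂ < β)
    (l₁ l₂ k : ℕ → ℕ)
    (hl₁ : ∀ n : ℕ, l₁ n = ⌈(n : ℝ) * (UNC.h W.θ + α₁)⌉₊)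
    (hl₂ : ∀ n : ℕ, l₂ n = ⌈(n : ℝ) * α₂⌉₊)
    (hk : ∀ n : ℕ, k n = ⌈(n : ℝ) * (UNC.h W.γ - UNC.h W.θ - β)⌉₊) :
    -- hash families as required by the protocol exist
    (∃ (G₁ : ∀ n : ℕ, UNC.HashFamily n (l₁ n)) (G₂ : ∀ n : ℕ, UNC.HashFamily n (l₂ n))
        (Ext : ∀ n : ℕ, UNC.HashFamily n (k n)),
      ∀ n : ℕ, (G₁ n).IsUniversal (4 * n) ∧ (G₂ n).IsUniversal 2 ∧ (Ext n).IsUniversal 2) ∧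
    -- for small slack `ν` of the distance test, the protocol with any such families is secure
    -- and has the claimed rate
    ∃ ν₀ : ℝ, 0 < ν₀ ∧ ∀ ν : ℝ, 0 < ν → ν < ν₀ →
      ∀ P : ∀ n : ℕ, UNC.HashProtocol n (l₁ n) (l₂ n) (k n),
      (∀ n : ℕ, (P n).ν = ν) →
      (∀ n : ℕ, (P n).G₁.IsUniversal (4 * n)) →
      (∀ n : ℕ, (P n).G₂.IsUniversal 2) →
      (∀ n : ℕ, (P n).Ext.IsUniversal 2) →
        UNC.Secure W P ∧
        ∀ n : ℕ, 0 < n →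
          UNC.h W.γ - UNC.h W.θ - β ≤ (P n).rate ∧
          (P n).rate < UNC.h W.γ - UNC.h W.θ - β + 1 / n := by
  have hlog : 0 < Real.log 2 := Real.log_pos one_lt_two
  have hθ := W.θ_pos
  have hθ' := W.θ_lt_half
  have hγ1 : W.γ < 1 := by linarith [W.γ_lt_δ, W.δ_lt_half]
  have hhθ : 0 ≤ UNC.h W.θ :=
    div_nonneg (Real.binEntropy_nonneg hθ.le (by linarith)) hlog.le
  have ceil_bounds : ∀ (n : ℕ) (r : ℝ), 0 ≤ r →
      n * r ≤ (⌈(n : ℝ) * r⌉₊ : ℝ) ∧ (⌈(n : ℝ) * r⌉₊ : ℝ) < n * r + 1 := fun n r hr =>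
    ⟨Nat.le_ceil _, Nat.ceil_lt_add_one (mul_nonneg (Nat.cast_nonneg n) hr)⟩
  have hl₁' : ∀ n : ℕ, n * (UNC.h W.θ + α₁) ≤ l₁ n ∧ (l₁ n : ℝ) < n * (UNC.h W.θ + α₁) + 1 :=
    fun n => by rw [hl₁ n]; exact ceil_bounds n _ (by linarith)
  have hl₂' : ∀ n : ℕ, n * α₂ ≤ l₂ n ∧ (l₂ n : ℝ) < n * α₂ + 1 :=
    fun n => by rw [hl₂ n]; exact ceil_bounds n _ hα₂.le
  have hk' : ∀ n : ℕ, n * (UNC.h W.γ - UNC.h W.θ - β) ≤ k n ∧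
      (k n : ℝ) < n * (UNC.h W.γ - UNC.h W.θ - β) + 1 :=
    fun n => by rw [hk n]; exact ceil_bounds n _ (by linarith)
  refine ⟨⟨fun n => UNC.HashFamily.all n (l₁ n), fun n => UNC.HashFamily.all n (l₂ n),
    fun n => UNC.HashFamily.all n (k n), fun n => ⟨UNC.HashFamily.all_isUniversal _ _ _,
      UNC.HashFamily.all_isUniversal _ _ _, UNC.HashFamily.all_isUniversal _ _ _⟩⟩, ?_⟩
  have hμ := W.slope_pos
  -- The bound `1` admits the Chernoff parameter; the other makes the growth of the compatible set
  -- due to the slack use at most half of the margin `α₁`.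
  refine ⟨min 1 (α₁ * Real.log 2 / (4 * W.slope)), lt_min one_pos (by positivity), ?_⟩
  intro ν hν0 hν P hPν hG₁ hG₂ hExt
  have hν1 : ν ≤ 1 := (hν.trans_le (min_le_left _ _)).le
  have hν2 : 2 * ν * W.slope ≤ α₁ * Real.log 2 / 2 := by
    have h1 := hν.trans_le (min_le_right _ _)
    rw [lt_div_iff₀ (by positivity)] at h1
    linarith
  refine ⟨?_, fun n hn => ?_⟩
  -- The entropy, in nats per channel use, left after the hash values and the extracted string.
  · set Δ : ℝ := (β - α₁ - α₂) * Real.log 2 with hΔ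
    have hΔ0 : 0 < Δ := mul_pos (by linarith) hlog
    obtain ⟨s, hs0, hs1, hφ⟩ := UNC.exists_rpow_add_rpow_le W.γ_pos hγ1
      (by positivity : 0 < Δ / 4)
    set C : ℝ := Real.exp ((Real.binEntropy W.θ + α₁ * Real.log 2 + 1) ^ 2 /
      (8 * (α₁ * Real.log 2)) + Real.log 2) with hC
    set εs : ℕ → ℝ := fun n => 2 * Real.exp (-(ν ^ 2 / 4) * n) with hεs
    set εc : ℕ → ℝ := fun n => (1 / Real.log 2) * Real.exp (-(Δ / 4) * n) +
      (Real.exp (3 * s * Real.log 2) / s / Real.log 2) * Real.exp (-(s * Δ / 2) * n) with hεc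
    set εb : ℕ → ℝ := fun n => C * Real.exp (-1 * n) +
      16 * (n * (n * Real.exp (-(α₂ * Real.log 2) * n))) with hεb
    have hεs0 : ∀ n, 0 ≤ εs n := fun n => by positivity
    have hεc0 : ∀ n, 0 ≤ εc n := fun n => by positivity
    have hεb0 : ∀ n, 0 ≤ εb n := fun n => by positivity
    have neg_s : UNC.Negligible εs := (UNC.negligible_exp (by positivity)).const_mul 2
    have neg_c : UNC.Negligible εc :=
      ((UNC.negligible_exp (by positivity)).const_mul _).add
        ((UNC.negligible_exp (by positivity)).const_mul _)
    have neg_b : UNC.Negligible εb :=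
      ((UNC.negligible_exp one_pos).const_mul C).add
        ((UNC.negligible_exp (a := α₂ * Real.log 2) (by positivity)).param_mul.param_mul.const_mul 16)
    refine ⟨fun n => εs n + εc n + εb n, (neg_s.add neg_c).add neg_b, fun n => ⟨?_, ?_, ?_⟩⟩
    · refine ((P n).sound_of_slack W (by rw [hPν]; exact hν0) (by rw [hPν]; exact hν1)).mono ?_
      rw [hPν]
      linarith [hεc0 n, hεb0 n]
    · refine ((P n).concealing_of_isUniversal W (hExt n) hs0 hs1
        (Real.exp_pos (-(Δ / 4) * n))).mono ?_
      have hlen : ((k n : ℝ) + l₁ n + l₂ n) * Real.log 2 ≤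
          n * (Real.binEntropy W.γ - Δ) + 3 * Real.log 2 := by
        rw [← UNC.h_mul_log_two, hΔ]
        -- Each of the three ceilings adds at most `1`.
        have h1 : (k n : ℝ) + l₁ n + l₂ n ≤ n * (UNC.h W.γ - (β - α₁ - α₂)) + 3 := by
          linarith [(hk' n).2, (hl₁' n).2, (hl₂' n).2]
        have h2 := mul_le_mul_of_nonneg_right h1 hlog.le
        linarith
      have hb := UNC.concealment_bound W.γ_pos hγ1 hs0 hlen hφ
      calc _ ≤ (Real.exp (-(Δ / 4) * n) +
            (Real.exp (3 * s * Real.log 2) * Real.exp (-(s * Δ / 2) * n)) / s) / Real.log 2 := by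
            gcongr
        _ = εc n := by simp only [hεc]; ring
        _ ≤ _ := by linarith [hεs0 n, hεb0 n]
    · refine ((P n).binding_of_slack W (by rw [hPν]; exact hν0) (by rw [hPν]; exact hν1)
        (hG₁ n) (hG₂ n)).mono ?_
      rw [hPν]
      have h1 : (n : ℝ) * (Real.binEntropy W.θ + α₁ * Real.log 2) ≤ l₁ n * Real.log 2 := by
        rw [← UNC.h_mul_log_two, ← add_mul, ← mul_assoc]
        exact mul_le_mul_of_nonneg_right (hl₁' n).1 hlog.le
      have h2 : l₁ n * Real.log 2 ≤
          (n : ℝ) * (Real.binEntropy W.θ + α₁ * Real.log 2) + Real.log 2 := by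
        rw [← UNC.h_mul_log_two]
        have := mul_le_mul_of_nonneg_right (hl₁' n).2.le hlog.le
        linarith
      have h3 := UNC.large_fibre_bound (by positivity) hν2 h1 h2
      have h4 : (4 * (n : ℝ)) ^ 2 * (2 ^ l₂ n)⁻¹ ≤
          16 * (n * (n * Real.exp (-(α₂ * Real.log 2) * n))) := by
        rw [UNC.two_pow_eq_exp, ← Real.exp_neg]
        calc (4 * (n : ℝ)) ^ 2 * Real.exp (-(l₂ n * Real.log 2)) ≤
              (4 * (n : ℝ)) ^ 2 * Real.exp (-(α₂ * Real.log 2) * n) := by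
              gcongr
              have := mul_le_mul_of_nonneg_right (hl₂' n).1 hlog.le
              linarith
          _ = _ := by ring
      have h5 := add_le_add h3 h4
      linarith [hεc0 n]
  · have hn' : (0 : ℝ) < n := by exact_mod_cast hn
    have hrate : (P n).rate = k n / n := by
      unfold UNC.HashProtocol.rate
      rw [UNC.card_bits]
      push_cast
      rw [Real.logb_pow, Real.logb_self_eq_one one_lt_two, mul_one]
    rw [hrate, le_div_iff₀ hn', div_lt_iff₀ hn', add_mul, one_div, inv_mul_cancel₀ hn'.ne']
    exact ⟨by linarith [(hk' n).1], by linarith [(hk' n).2]⟩
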